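/- **Theorem 2 (asymptotic mmW UDN spectral efficiency).** *Model.* In the Euclidean plane, base stations (BSs) form a homogeneous Poisson point process of density $\lambda_m$ and users an independent homogeneous Poisson point process of density $\lambda_u$; put $\hat\lambda_m=\lambda_m/\lambda_u$. Every user is associated with its nearest BS. Every BS that has associated users is active and selects one of them uniformly at random; the other BSs are silent. An active transmitter has a main lobe of width $\theta\in(0,2\pi]$, centred on the direction of its intended receiver, and no side lobes. A link of length $r$ has gain $g\,r^{-\alpha_m}\mathbf 1[r\le R_L]$, where $\alpha_m>2$, $R_L>0$ is the line-of-sight distance, and the fading powers $g$ are i.i.d. exponential with mean $1$. Let $P_{m.d},P_{m.u}>0$ be the transmission powers and $\sigma^2>0$ the noise power. Downlink: a typical user is added at the origin; it is served by its nearest BS, at distance $r$, and $$\mathsf{SINR}_{m.d}=\frac{P_{m.d}\,g\,r^{-\alpha_m}\mathbf 1[r\le R_L]}{\sum_i \Theta_i P_{m.d}\,g_i r_i^{-\alpha_m}\mathbf 1[r_i\le R_L]+\sigma^2},$$ where the sum is over the other active BSs, at distances $r_i$ from the origin, and $\Theta_i\in\{0,1\}$ indicates that the main lobe of the $i$-th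 one covers the origin. Put $\gamma_{m.d}=\mathsf E\log(1+\mathsf{SINR}_{m.d})$. Uplink: a typical BS is added at the origin; $\mathsf{SINR}_{m.u}$ is given by the same formula with $P_{m.u}$ in place of $P_{m.d}$, with $r$ the distance of the user that this BS selects, and with the sum over the users selected by the other BSs, whose main lobes point at those BSs. Put $\gamma_{m.u}=\mathsf E[\log(1+\mathsf{SINR}_{m.u})\mid\text{the typical BS is active}]$. *Claim.* Both expectations are finite and, as $\hat\lambda_m\to\infty$, the DL and UL spectral efficiencies have the same asymptotic value $$\gamma_m=\frac{\alpha_m p_L}{2}\log\hat\lambda_m,\qquad p_L=1-\exp(-\lambda_m\pi R_L^2),$$ that is, $$\lim_{\hat\lambda_m\to\infty}\frac{\gamma_{m.d}}{\gamma_m}=\lim_{\hat\lambda_m\to\infty}\frac{\gamma_{m.u}}{\gamma_m}=1 .$$ Here $\alpha_m,\theta,P_{m.d},P_{m.u},\sigma^2$ are fixed. The limit holds in particular when $\lambda_u$ and $R_L$ are fixed and $\lambda_m\to\infty$, and more generally when $\lambda_u$ and $R_L$ vary in such a way that $\log\lambda_u=o(\log\hat\lambda_m)$ and $p_L$ stays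 bounded away from $0$. -/

import Mathlib

open MeasureTheory ProbabilityTheory Filter Topology Asymptotics

noncomputable section

/-- The Euclidean plane, with Lebesgue measure as `volume`. -/
abbrev Plane : Type := EuclideanSpace ℝ (Fin 2)

/-- `Q` is the law of (an enumeration of) a homogeneous Poisson point process on the plane with
density `lam`: the numbers of points in disjoint Borel sets of finite area are independent Poisson
variables whose means are `lam` times the areas. -/
structure IsPoissonProcess (Q : Measure (ℕ → Plane)) (lam : ℝ) : Prop where
  prob : IsProbabilityMeasure Q
  counts : ∀ (n : ℕ) (B : Fin n → Set Plane) (k : Fin n → ℕ),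
    (∀ j, MeasurableSet (B j)) → (∀ j, volume (B j) ≠ ⊤) →
    (∀ j j', j ≠ j' → Disjoint (B j) (B j')) →
    Q {x | ∀ j, {i | x i ∈ B j}.encard = (k j : ℕ∞)} =
      ∏ j, poissonMeasure (lam * (volume (B j)).toReal).toNNReal {k j}

/-- A receiver at `z` is associated with the `i`-th base station (BS): no BS is nearer to `z`, that
is, `z` lies in the Voronoi cell of `x i`. -/
def Assoc {ι : Type*} (x : ι → Plane) (i : ι) (z : Plane) : Prop :=
  ∀ k, dist z (x i) ≤ dist z (x k)

/-- The `i`-th BS selects the `j`-th user. The marks `u` are independent and uniform on `[0, 1]`, so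
the associated user of least mark is a uniformly random one among the associated users of the BS.
A BS is active if it selects some user; this happens when it has associated users. -/
def Scheduled {ι : Type*} (x : ι → Plane) (y : ℕ → Plane) (u : ℕ → unitInterval)
    (i : ι) (j : ℕ) : Prop :=
  Assoc x i (y j) ∧ ∀ k, Assoc x i (y k) → u j ≤ u k

/-- The main lobe of width `θ` of a transmitter at `a` whose beam centre points at `b` covers the
location `z`. -/
def InBeam (θ : ℝ) (a b z : Plane) : Prop :=
  InnerProductGeometry.angle (b - a) (z - a) ≤ θ / 2

open Classical in
/-- Path loss with exponent `α` times the line-of-sight indicator: a link of length `r` is blocked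
when `r` exceeds the LOS distance `R`. -/
def pathGain (α R r : ℝ) : ℝ := if r ≤ R then r ^ (-α) else 0

open Classical in
/-- Downlink interference at a typical user located at the origin. The interferers are the active
BSs, except the BS that serves the origin, whose main lobe (pointing at the selected user) covers
the origin. Here `x`, `y` are the BSs and the other users, `u` the scheduling marks, `g` the fading
powers and `P` the transmission power. -/
def dlInterference (α θ R P : ℝ) (x y : ℕ → Plane) (u : ℕ → unitInterval) (g : ℕ → ℝ) : ENNReal :=
  ∑' i, if ¬ Assoc x i 0 ∧ ∃ j, Scheduled x y u i j ∧ InBeam θ (x i) (y j) 0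
    then ENNReal.ofReal (P * g i * pathGain α R ‖x i‖) else 0

/-- Downlink SINR at a typical user located at the origin, served by the nearest BS; `h` is the
fading power of the desired link and `N` the noise power. -/
def dlSINR (α θ R P N : ℝ) (x y : ℕ → Plane) (u : ℕ → unitInterval) (h : ℝ) (g : ℕ → ℝ) : ℝ :=
  (ENNReal.ofReal (P * h * pathGain α R (⨅ i, ‖x i‖)) /
    (dlInterference α θ R P x y u g + ENNReal.ofReal N)).toReal

/-- The BSs `x` together with a typical BS at the origin, which has the index `none`. -/
def withOrigin (x : ℕ → Plane) : Option ℕ → Plane := fun o => o.elim 0 x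

/-- The typical BS at the origin is active. -/
def OriginActive (x y : ℕ → Plane) (u : ℕ → unitInterval) : Prop :=
  ∃ j, Scheduled (withOrigin x) y u none j

open Classical in
/-- Uplink interference at a typical BS located at the origin. The interferers are the users that
are selected by other BSs and whose main lobe (pointing at the BS that selects them) covers the
origin. -/
def ulInterference (α θ R P : ℝ) (x y : ℕ → Plane) (u : ℕ → unitInterval) (g : ℕ → ℝ) : ENNReal :=
  ∑' j, if ∃ i : ℕ, Scheduled (withOrigin x) y u (some i) j ∧ InBeam θ (y j) (x i) 0
    then ENNReal.ofReal (P * g j * pathGain α R ‖y j‖) else 0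

open Classical in
/-- Power received by a typical BS located at the origin from the user that it selects. -/
def ulSignal (α R P : ℝ) (x y : ℕ → Plane) (u : ℕ → unitInterval) (h : ℝ) : ENNReal :=
  ∑' j, if Scheduled (withOrigin x) y u none j
    then ENNReal.ofReal (P * h * pathGain α R ‖y j‖) else 0

/-- Uplink SINR at a typical BS located at the origin. -/
def ulSINR (α θ R P N : ℝ) (x y : ℕ → Plane) (u : ℕ → unitInterval) (h : ℝ) (g : ℕ → ℝ) : ℝ :=
  (ulSignal α R P x y u h / (ulInterference α θ R P x y u g + ENNReal.ofReal N)).toReal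

/-- A sample of the network: BSs, users, scheduling marks, fading power of the desired link, fading
powers of the interfering links. -/
abbrev Sample : Type := (ℕ → Plane) × (ℕ → Plane) × (ℕ → unitInterval) × ℝ × (ℕ → ℝ)

/-- The law of the network: BSs with law `QB`, users with law `QU`, uniform marks and unit mean
exponential (Rayleigh) fading powers, all independent. -/
def networkLaw (QB QU : Measure (ℕ → Plane)) : Measure Sample :=
  QB.prod (QU.prod ((Measure.infinitePi fun _ : ℕ => (volume : Measure unitInterval)).prod
    ((expMeasure 1).prod (Measure.infinitePi fun _ : ℕ => expMeasure 1))))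

/-- The law of the network as seen from a typical active BS at the origin. -/
def activeLaw (QB QU : Measure (ℕ → Plane)) : Measure Sample :=
  ProbabilityTheory.cond (networkLaw QB QU) {s | OriginActive s.1 s.2.1 s.2.2.1}

/-- Instantaneous downlink capacity `log (1 + SINR)`, in nats. -/
def dlCapacity (α θ R P N : ℝ) (s : Sample) : ℝ :=
  Real.log (1 + dlSINR α θ R P N s.1 s.2.1 s.2.2.1 s.2.2.2.1 s.2.2.2.2)

/-- Instantaneous uplink capacity `log (1 + SINR)`, in nats. -/
def ulCapacity (α θ R P N : ℝ) (s : Sample) : ℝ :=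
  Real.log (1 + ulSINR α θ R P N s.1 s.2.1 s.2.2.1 s.2.2.2.1 s.2.2.2.2)

/-- Downlink spectral efficiency: the ergodic capacity at a typical user. -/
def seDL (α θ R P N : ℝ) (QB QU : Measure (ℕ → Plane)) : ℝ :=
  ∫ s, dlCapacity α θ R P N s ∂(networkLaw QB QU)

/-- Uplink spectral efficiency: the ergodic capacity at a typical active BS. -/
def seUL (α θ R P N : ℝ) (QB QU : Measure (ℕ → Plane)) : ℝ :=
  ∫ s, ulCapacity α θ R P N s ∂(activeLaw QB QU)

/-- Average LOS probability for BS density `lamM` and LOS distance `R`. -/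
def losProb (lamM R : ℝ) : ℝ := 1 - Real.exp (-(lamM * Real.pi * R ^ 2))

/-- The asymptotic spectral efficiency `(α p_L / 2) log (lamM / lamU)`. -/
def seLimit (α R lamM lamU : ℝ) : ℝ := α * losProb lamM R / 2 * Real.log (lamM / lamU)

end

/-!
Both spectral efficiencies are squeezed between bounds whose ratio to `seLimit` tends to `1`. Write
`ratio = lamM / lamU`. The serving link is a nearest-neighbour link of the BS process, so its length
`r` is of order `lamM ^ (-1/2)` and its path gain, when it is not blocked, is of order
`lamM ^ (α/2)`; noise, fading and interference only contribute `o(log ratio)` to the logarithm.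

**Upper bound.** Dropping the interference, `log_one_add_mul_pathGain_le` bounds the capacity by
`P h / N + (α/2) log⁺ lamM` if `r ≤ R`, plus a term for the links shorter than `lamM ^ (-1/2)` whose
mean is bounded. In the downlink `r ≤ R` has probability `losProb lamM R`, as `r > R` is the event
that a disc is void (`lintegral_dlCapacity_le`). In the uplink the sum over the users in the Voronoi
cell of the origin is averaged instead: by Campbell's formula its intensity is
`lamU exp (-lamM π ‖z‖²)`, which has mass `losProb lamM R / ratio` in the disc of radius `R`
(`lintegral_ulCapacity_le`). Dividing by the probability that the typical BS is active gives the
same leading term, because this probability lies between `ratio⁻¹ (1 - 2 / ratio)` and `ratio⁻¹`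
(`activeProb_bounds`, which needs only the first two moments of the area of the cell).

**Lower bound.** The capacity is at least `guaranteedCapacity` as soon as the link is not longer
than `goodRadius`, its fading power is at least `ε` and the interference is at most
`interferenceLevel`. The point is that the interference is of order `lamU ^ (α/2)` in probability,
however dense the BSs are: there is at most one active transmitter per user.
* Downlink: an active BS lies near the user that it selects, so with high probability the
  interference is at most a fading-weighted sum of `(‖y‖ / 2) ^ (-α)` over the users, none of which
  is near the origin (`dlInterference_le`, `networkLaw_lt_dlInterference_le`).
* Uplink: the interferers are users outside the cell of the origin. Given the BSs, these are
  independent of the users inside the cell, hence of the activity of the typical BS, so conditioning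
  on an event whose probability tends to `0` does no harm
  (`networkLaw_hasUser_lt_ulInterference_le`).

With `ε = 1 / log ratio` the loss of probability vanishes, and `guaranteedCapacity` is at least
`(α/2) log ratio - O(|log lamU| + log log ratio)`; the hypothesis `log lamU = o(log ratio)` then
gives the limit (`tendsto_div_seLimit`). The width of the main lobes plays no role at this order.

Of the Poisson processes only local finiteness, void probabilities and Campbell's formula are used,
the latter also restricted to the event that a region is void, or is not void, for sums over the
points outside that region (`setLIntegral_void_tsum`, `setLIntegral_exists_tsum`). The void version
also shows that on average at most two BSs are nearest to a given location
(`lintegral_tsum_assoc_le`), which is all that the downlink needs to know about ties.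
-/

open scoped ENNReal

noncomputable section

/-! ### Radial integrals over the plane -/

theorem lintegral_norm_plane {f : ℝ → ℝ} (hf : ∀ r, 0 ≤ f r)
    (hi : IntegrableOn (fun r => r * f r) (Set.Ioi 0)) :
    ∫⁻ z : Plane, ENNReal.ofReal (f ‖z‖) =
      ENNReal.ofReal (2 * Real.pi * ∫ r in Set.Ioi (0 : ℝ), r * f r) := by
  have h2 : Module.finrank ℝ Plane = 2 := by simp
  have hint : Integrable (fun z : Plane => f ‖z‖) := by
    rw [integrable_fun_norm_addHaar volume (f := f), h2]
    simpa using hi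
  rw [← ofReal_integral_eq_lintegral_ofReal hint (Eventually.of_forall fun z => hf _),
    integral_fun_norm_addHaar volume f, h2]
  congr 1
  have : (volume : Measure Plane).real (Metric.ball 0 1) = Real.pi := by
    simp [Measure.real, EuclideanSpace.volume_ball_fin_two, Real.pi_pos.le]
  rw [this]
  simp
  ring

theorem setLIntegral_norm_plane {f : ℝ → ℝ} {s : Set ℝ} (hs : MeasurableSet s)
    (hs0 : s ⊆ Set.Ioi 0) {t : Set Plane} (ht : MeasurableSet t)
    (hts : ∀ z : Plane, z ∈ t ↔ ‖z‖ ∈ s) (hf : ∀ r ∈ s, 0 ≤ f r)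
    (hi : IntegrableOn (fun r => r * f r) s) :
    ∫⁻ z in t, ENNReal.ofReal (f ‖z‖) =
      ENNReal.ofReal (2 * Real.pi * ∫ r in s, r * f r) := by
  have h1 : (fun r : ℝ => r * s.indicator f r) = s.indicator (fun r => r * f r) := by
    funext r; by_cases hr : r ∈ s <;> simp [hr]
  have := lintegral_norm_plane (f := s.indicator f) (fun r => Set.indicator_nonneg hf r)
    (by rw [h1]; exact ((integrable_indicator_iff hs).2 hi).integrableOn)
  rw [h1, setIntegral_indicator hs, Set.inter_eq_right.2 hs0] at this
  rw [← this, ← lintegral_indicator ht]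
  congr 1; funext z
  by_cases hz : z ∈ t
  · simp [hz, (hts z).1 hz]
  · simp [hz, mt (hts z).2 hz]

/-- The mass outside a disc of the density `exp (-b π r²)`. -/
theorem setLIntegral_exp_neg_sq_compl_closedBall {b ρ : ℝ} (hb : 0 < b) (hρ : 0 ≤ ρ) :
    ∫⁻ z in (Metric.closedBall (0 : Plane) ρ)ᶜ,
        ENNReal.ofReal (Real.exp (-(b * Real.pi * ‖z‖ ^ 2)))
      = ENNReal.ofReal (Real.exp (-(b * Real.pi * ρ ^ 2)) / b) := by
  have hpi := Real.pi_pos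
  have hbp : 0 < b * Real.pi := by positivity
  let g : ℝ → ℝ := fun r => -(Real.exp (-(b * Real.pi * r ^ 2)) / (2 * (b * Real.pi)))
  have hder : ∀ r ∈ Set.Ici ρ, HasDerivAt g (r * Real.exp (-(b * Real.pi * r ^ 2))) r := by
    intro r _
    have h := ((((hasDerivAt_pow 2 r).const_mul (b * Real.pi)).fun_neg).exp.div_const
      (2 * (b * Real.pi))).fun_neg
    refine h.congr_deriv ?_
    field_simp
    simp [mul_comm]
  have hpos : ∀ r ∈ Set.Ioi ρ, 0 ≤ r * Real.exp (-(b * Real.pi * r ^ 2)) := fun r hr =>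
    mul_nonneg (hρ.trans (le_of_lt hr)) (Real.exp_pos _).le
  have hlim : Tendsto g atTop (𝓝 0) := by
    have h1 : Tendsto (fun r : ℝ => b * Real.pi * r ^ 2) atTop atTop :=
      (tendsto_pow_atTop two_ne_zero).const_mul_atTop hbp
    have h2 := ((Real.tendsto_exp_neg_atTop_nhds_zero.comp h1).div_const (2 * (b * Real.pi))).neg
    simpa [g, Function.comp_def] using h2
  rw [setLIntegral_norm_plane (f := fun r => Real.exp (-(b * Real.pi * r ^ 2)))
    (measurableSet_Ioi (a := ρ)) (Set.Ioi_subset_Ioi hρ)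
    Metric.isClosed_closedBall.measurableSet.compl (by simp) (fun r _ => (Real.exp_pos _).le)
    (integrableOn_Ioi_deriv_of_nonneg' hder hpos hlim),
    integral_Ioi_of_hasDerivAt_of_nonneg' hder hpos hlim]
  congr 1
  simp only [g]
  field_simp
  simp

theorem lintegral_exp_neg_sq {b : ℝ} (hb : 0 < b) :
    ∫⁻ z : Plane, ENNReal.ofReal (Real.exp (-(b * Real.pi * ‖z‖ ^ 2)))
      = ENNReal.ofReal (1 / b) := by
  have h := setLIntegral_exp_neg_sq_compl_closedBall hb le_rfl
  rw [← lintegral_add_compl _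
    (Metric.isClosed_closedBall (x := (0 : Plane)) (ε := 0)).measurableSet, h,
    setLIntegral_measure_zero _ _ (by simp)]
  simp

/-- The mass inside a disc of the density `exp (-b π r²)`. -/
theorem setLIntegral_exp_neg_sq_closedBall {b ρ : ℝ} (hb : 0 < b) (hρ : 0 ≤ ρ) :
    ∫⁻ z in Metric.closedBall (0 : Plane) ρ,
        ENNReal.ofReal (Real.exp (-(b * Real.pi * ‖z‖ ^ 2)))
      = ENNReal.ofReal ((1 - Real.exp (-(b * Real.pi * ρ ^ 2))) / b) := by
  have h := lintegral_add_compl (μ := volume)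
    (fun z : Plane => ENNReal.ofReal (Real.exp (-(b * Real.pi * ‖z‖ ^ 2))))
    (Metric.isClosed_closedBall (x := (0 : Plane)) (ε := ρ)).measurableSet
  rw [lintegral_exp_neg_sq hb, setLIntegral_exp_neg_sq_compl_closedBall hb hρ] at h
  rw [ENNReal.eq_sub_of_add_eq ENNReal.ofReal_ne_top h, ← ENNReal.ofReal_sub _ (by positivity)]
  congr 1
  field_simp

theorem setLIntegral_rpow_compl_closedBall {α s : ℝ} (hα : 2 < α) (hs : 0 < s) :
    ∫⁻ z in (Metric.closedBall (0 : Plane) s)ᶜ, ENNReal.ofReal (‖z‖ ^ (-α))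
      = ENNReal.ofReal (2 * Real.pi / (α - 2) * s ^ (2 - α)) := by
  have hcongr : Set.EqOn (fun r : ℝ => r * r ^ (-α)) (fun r => r ^ (1 - α)) (Set.Ioi s) := by
    intro r hr
    have hr0 : 0 < r := hs.trans hr
    simp only
    rw [sub_eq_add_neg, Real.rpow_add hr0, Real.rpow_one]
  rw [setLIntegral_norm_plane (f := fun r => r ^ (-α)) (measurableSet_Ioi (a := s))
    (Set.Ioi_subset_Ioi hs.le) Metric.isClosed_closedBall.measurableSet.compl (by simp)
    (fun r hr => Real.rpow_nonneg (hs.trans hr).le _)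
    ((integrableOn_Ioi_rpow_of_lt (by linarith) hs).congr_fun hcongr.symm measurableSet_Ioi),
    setIntegral_congr_fun measurableSet_Ioi hcongr, integral_Ioi_rpow_of_lt (by linarith) hs]
  congr 1
  rw [show 1 - α + 1 = -(α - 2) by ring, show 2 - α = -(α - 2) by ring]
  have : α - 2 ≠ 0 := by linarith
  field_simp

theorem setLIntegral_inv_norm_closedBall {ρ : ℝ} (hρ : 0 ≤ ρ) :
    ∫⁻ z in Metric.closedBall (0 : Plane) ρ, ENNReal.ofReal (‖z‖⁻¹)
      = ENNReal.ofReal (2 * Real.pi * ρ) := by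
  have hcongr : Set.EqOn (fun r : ℝ => r * r⁻¹) (fun r => 1) (Set.Ioc 0 ρ) :=
    fun r hr => mul_inv_cancel₀ hr.1.ne'
  have h0 : ∫⁻ z in Metric.closedBall (0 : Plane) ρ, ENNReal.ofReal (‖z‖⁻¹) =
      ∫⁻ z in Metric.closedBall (0 : Plane) ρ \ {0}, ENNReal.ofReal (‖z‖⁻¹) :=
    setLIntegral_congr (sdiff_null_ae_eq_self (by simp)).symm
  rw [h0, setLIntegral_norm_plane (f := fun r => r⁻¹) (measurableSet_Ioc (a := 0) (b := ρ))
    (fun r hr => hr.1) (Metric.isClosed_closedBall.measurableSet.diff (measurableSet_singleton _))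
    (by simp [and_comm]) (fun r hr => inv_nonneg.2 hr.1.le)
    ((integrableOn_const (by simp)).congr_fun hcongr.symm measurableSet_Ioc),
    setIntegral_congr_fun measurableSet_Ioc hcongr]
  simp [hρ]

/-! ### Counts of a Poisson process -/

/-- Counts as sums of indicators: the bridge from the definition of a Poisson process to Campbell's
formula. -/
theorem toENNReal_encard (x : ℕ → Plane) (B : Set Plane) :
    (({i | x i ∈ B}.encard : ℕ∞) : ℝ≥0∞) = ∑' i, B.indicator 1 (x i) := by
  rw [← ENNReal.tsum_set_one, tsum_subtype {i | x i ∈ B} fun _ => (1 : ℝ≥0∞)]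
  rfl

theorem measurableSet_encard_eq {B : Set Plane} (hB : MeasurableSet B) (k : ℕ) :
    MeasurableSet {x : ℕ → Plane | {i | x i ∈ B}.encard = (k : ℕ∞)} := by
  have : {x : ℕ → Plane | {i | x i ∈ B}.encard = (k : ℕ∞)} =
      {x | ∑' i, B.indicator (1 : Plane → ℝ≥0∞) (x i) = k} := by
    ext x
    simp only [Set.mem_ofPred_eq, ← toENNReal_encard]
    rw [← ENat.toENNReal_coe, ENat.toENNReal_inj]
  rw [this]
  have hm : Measurable fun x : ℕ → Plane => ∑' i, B.indicator (1 : Plane → ℝ≥0∞) (x i) :=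
    Measurable.tsum fun i => (measurable_one.indicator hB).comp (measurable_pi_apply i)
  exact hm (measurableSet_singleton _)

theorem tsum_natCast_mul_poissonMeasure (r : NNReal) :
    ∑' m : ℕ, (m : ℝ≥0∞) * poissonMeasure r {m} = r := by
  have h1 : ∑' m : ℕ, poissonMeasure r {m} = 1 := by
    have := (lintegral_countable' (μ := poissonMeasure r) fun _ => 1)
    simpa using this.symm
  rw [tsum_eq_zero_add' ENNReal.summable]
  simp only [Nat.cast_zero, zero_mul, zero_add]
  have h2 : ∀ m : ℕ, ((m + 1 : ℕ) : ℝ≥0∞) * poissonMeasure r {m + 1} =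
      r * poissonMeasure r {m} := by
    intro m
    rw [poissonMeasure_singleton, poissonMeasure_singleton, ← ENNReal.ofReal_natCast,
      ← ENNReal.ofReal_coe_nnreal, ← ENNReal.ofReal_mul (by positivity),
      ← ENNReal.ofReal_mul (by positivity)]
    congr 1
    rw [Nat.factorial_succ]
    push_cast
    field_simp
    ring
  simp_rw [h2]
  rw [ENNReal.tsum_mul_left, h1, mul_one]

namespace IsPoissonProcess

variable {Q : Measure (ℕ → Plane)} {lam : ℝ}

theorem count_eq (h : IsPoissonProcess Q lam) {B : Set Plane} (hB : MeasurableSet B)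
    (hB' : volume B ≠ ⊤) (k : ℕ) :
    Q {x | {i | x i ∈ B}.encard = (k : ℕ∞)} =
      poissonMeasure (lam * (volume B).toReal).toNNReal {k} := by
  have := h.counts 1 (fun _ => B) (fun _ => k) (fun _ => hB) (fun _ => hB')
    (fun j j' hj => absurd (Subsingleton.elim j j') hj)
  simpa using this

theorem count_eq_and_count_eq (h : IsPoissonProcess Q lam) {A B : Set Plane}
    (hA : MeasurableSet A) (hA' : volume A ≠ ⊤) (hB : MeasurableSet B)
    (hB' : volume B ≠ ⊤) (hAB : Disjoint A B) (k m : ℕ) :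
    Q ({x | {i | x i ∈ A}.encard = (k : ℕ∞)} ∩ {x | {i | x i ∈ B}.encard = (m : ℕ∞)}) =
      Q {x | {i | x i ∈ A}.encard = (k : ℕ∞)} * Q {x | {i | x i ∈ B}.encard = (m : ℕ∞)} := by
  have := h.counts 2 ![A, B] ![k, m] (by simp [Fin.forall_fin_two, hA, hB])
    (by simp [Fin.forall_fin_two, hA', hB'])
    (by simp [Fin.forall_fin_two, hAB, hAB.symm])
  simp only [Fin.forall_fin_two, Fin.prod_univ_two, Matrix.cons_val_zero,
    Matrix.cons_val_one] at this
  rw [h.count_eq hA hA', h.count_eq hB hB', ← this]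
  rfl

theorem ae_finite_setOf_mem (h : IsPoissonProcess Q lam) {B : Set Plane} (hB : MeasurableSet B)
    (hB' : volume B ≠ ⊤) : ∀ᵐ x ∂Q, {i | x i ∈ B}.Finite := by
  have := h.prob
  have hd : Pairwise (Function.onFun Disjoint
      fun k : ℕ => {x : ℕ → Plane | {i | x i ∈ B}.encard = (k : ℕ∞)}) := by
    intro k m hkm
    refine Set.disjoint_left.2 fun x hx hx' => hkm ?_
    simp only [Set.mem_ofPred_eq] at hx hx'
    exact_mod_cast hx.symm.trans hx'
  have hm := measurableSet_encard_eq hB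
  have hU : Q (⋃ k : ℕ, {x | {i | x i ∈ B}.encard = (k : ℕ∞)}) = 1 := by
    rw [measure_iUnion hd hm]
    simp_rw [h.count_eq hB hB']
    have := (lintegral_countable' (μ := poissonMeasure (lam * (volume B).toReal).toNNReal)
      fun _ => 1)
    simpa using this.symm
  have h2 := (prob_compl_eq_zero_iff (MeasurableSet.iUnion hm)).2 hU
  filter_upwards [compl_mem_ae_iff.2 h2] with x hx
  simp only [compl_compl, Set.mem_iUnion, Set.mem_ofPred_eq] at hx
  obtain ⟨k, hk⟩ := hx
  exact Set.finite_of_encard_eq_coe hk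

theorem forall_notMem_eq (x : ℕ → Plane) (B : Set Plane) :
    (∀ i, x i ∉ B) ↔ {i | x i ∈ B}.encard = ((0 : ℕ) : ℕ∞) := by
  simp [Set.eq_empty_iff_forall_notMem]

/-- The void probability. -/
theorem void (h : IsPoissonProcess Q lam) (hlam : 0 ≤ lam) {B : Set Plane} (hB : MeasurableSet B)
    (hB' : volume B ≠ ⊤) :
    Q {x | ∀ i, x i ∉ B} = ENNReal.ofReal (Real.exp (-(lam * (volume B).toReal))) := by
  simp_rw [forall_notMem_eq]
  rw [h.count_eq hB hB', poissonMeasure_singleton]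
  simp [Real.coe_toNNReal _ (mul_nonneg hlam ENNReal.toReal_nonneg)]

/-- The mean count of a set of finite area, on an event that is independent of the count. -/
theorem setLIntegral_count (h : IsPoissonProcess Q lam) (hlam : 0 ≤ lam) {E : Set (ℕ → Plane)}
    {B : Set Plane} (hB : MeasurableSet B) (hB' : volume B ≠ ⊤)
    (hind : ∀ m : ℕ, Q (E ∩ {x | {i | x i ∈ B}.encard = (m : ℕ∞)}) =
      Q E * Q {x | {i | x i ∈ B}.encard = (m : ℕ∞)}) :
    ∫⁻ x in E, ∑' i, B.indicator (1 : Plane → ℝ≥0∞) (x i) ∂Q =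
      Q E * (ENNReal.ofReal lam * volume B) := by
  have hm := measurableSet_encard_eq hB
  have h1 : ∀ᵐ x ∂(Q.restrict E), ∑' i, B.indicator (1 : Plane → ℝ≥0∞) (x i) =
      ∑' m : ℕ, {x : ℕ → Plane | {i | x i ∈ B}.encard = (m : ℕ∞)}.indicator
        (fun _ => (m : ℝ≥0∞)) x := by
    filter_upwards [ae_restrict_of_ae (h.ae_finite_setOf_mem hB hB')] with x hx
    rw [← toENNReal_encard, hx.encard_eq_coe_toFinset_card, tsum_eq_single hx.toFinset.card]
    · simp [hx.encard_eq_coe_toFinset_card]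
    · intro m hm
      refine Set.indicator_of_notMem (fun hm' => hm ?_) _
      rw [Set.mem_ofPred_eq, hx.encard_eq_coe_toFinset_card] at hm'
      exact_mod_cast hm'.symm
  rw [lintegral_congr_ae h1,
    lintegral_tsum fun m => (measurable_const.indicator (hm m)).aemeasurable]
  have h2 : ∀ m : ℕ, ∫⁻ x in E, {x : ℕ → Plane | {i | x i ∈ B}.encard = (m : ℕ∞)}.indicator
        (fun _ => (m : ℝ≥0∞)) x ∂Q =
      Q E * (m * poissonMeasure (lam * (volume B).toReal).toNNReal {m}) := by
    intro m
    rw [lintegral_indicator_const (hm m), Measure.restrict_apply (hm m), Set.inter_comm, hind m,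
      h.count_eq hB hB']
    ring
  simp_rw [h2]
  rw [ENNReal.tsum_mul_left, tsum_natCast_mul_poissonMeasure]
  congr 1
  rw [← ENNReal.ofReal_coe_nnreal, Real.coe_toNNReal _ (by positivity), ENNReal.ofReal_mul hlam,
    ENNReal.ofReal_toReal hB']

/-- Campbell's formula in a region, on an event that is independent of the counts there. -/
theorem setLIntegral_tsum_of_indep (h : IsPoissonProcess Q lam) (hlam : 0 ≤ lam)
    {E : Set (ℕ → Plane)} {W : Set Plane} (hW : MeasurableSet W)
    (hind : ∀ B, MeasurableSet B → volume B ≠ ⊤ → B ⊆ W → ∀ m : ℕ,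
      Q (E ∩ {x | {i | x i ∈ B}.encard = (m : ℕ∞)}) =
      Q E * Q {x | {i | x i ∈ B}.encard = (m : ℕ∞)}) {f : Plane → ℝ≥0∞} (hf : Measurable f) :
    ∫⁻ x in E, ∑' i, W.indicator f (x i) ∂Q = Q E * (ENNReal.ofReal lam * ∫⁻ z in W, f z) := by
  -- `μ` is the intensity measure of the points on the event `E`. It agrees with a multiple of
  -- Lebesgue measure on the bounded subsets of `W`, where the counts have finite mean.
  let μ : Measure Plane := Measure.sum fun i => (Q.restrict E).map fun x : ℕ → Plane => x i
  have hμ : ∀ f : Plane → ℝ≥0∞, Measurable f →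
      ∫⁻ z, f z ∂μ = ∫⁻ x in E, ∑' i, f (x i) ∂Q := by
    intro f hf
    rw [lintegral_sum_measure, lintegral_tsum (f := fun i (x : ℕ → Plane) => f (x i))
      fun i => (hf.comp (measurable_pi_apply i)).aemeasurable]
    exact tsum_congr fun i => lintegral_map hf (measurable_pi_apply i)
  have key : μ.restrict W = (Q E * ENNReal.ofReal lam) • volume.restrict W := by
    refine (Measure.ext_iff_of_iUnion_eq_univ (s := fun n : ℕ => Metric.ball (0 : Plane) n)
      (Metric.iUnion_ball_nat 0)).2 fun n => Measure.ext fun A hA => ?_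
    have hb : MeasurableSet (Metric.ball (0 : Plane) n) := Metric.isOpen_ball.measurableSet
    rw [Measure.restrict_apply hA, Measure.restrict_apply (hA.inter hb),
      Measure.restrict_apply hA, Measure.smul_apply, Measure.restrict_apply (hA.inter hb)]
    have hB : MeasurableSet (A ∩ Metric.ball (0 : Plane) n ∩ W) := (hA.inter hb).inter hW
    have hB' : volume (A ∩ Metric.ball (0 : Plane) n ∩ W) ≠ ⊤ :=
      measure_ne_top_of_subset (Set.inter_subset_left.trans Set.inter_subset_right)
        Metric.isBounded_ball.measure_lt_top.ne
    rw [← lintegral_indicator_one hB, hμ _ (measurable_one.indicator hB),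
      h.setLIntegral_count hlam hB hB' (hind _ hB hB' Set.inter_subset_right), smul_eq_mul,
      mul_assoc]
  rw [← hμ _ (hf.indicator hW), lintegral_indicator hW, key, lintegral_smul_measure, smul_eq_mul,
    mul_assoc]

/-- Campbell's formula. -/
theorem campbell (h : IsPoissonProcess Q lam) (hlam : 0 ≤ lam) {f : Plane → ℝ≥0∞}
    (hf : Measurable f) :
    ∫⁻ x, ∑' i, f (x i) ∂Q = ENNReal.ofReal lam * ∫⁻ z, f z := by
  have := h.prob
  have h1 := h.setLIntegral_tsum_of_indep hlam (E := Set.univ) MeasurableSet.univ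
    (fun B _ _ _ m => by simp) hf
  simpa using h1

/-- Campbell's formula outside a set `B`, on the event that `B` contains no point. -/
theorem setLIntegral_void_tsum (h : IsPoissonProcess Q lam) (hlam : 0 ≤ lam) {B : Set Plane}
    (hB : MeasurableSet B) (hB' : volume B ≠ ⊤) {f : Plane → ℝ≥0∞} (hf : Measurable f) :
    ∫⁻ x in {x | ∀ i, x i ∉ B}, ∑' i, Bᶜ.indicator f (x i) ∂Q =
      Q {x | ∀ i, x i ∉ B} * (ENNReal.ofReal lam * ∫⁻ z in Bᶜ, f z) := by
  simp_rw [forall_notMem_eq]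
  refine h.setLIntegral_tsum_of_indep hlam hB.compl ?_ hf
  intro A hA hA' hAB m
  exact h.count_eq_and_count_eq hB hB' hA hA' (Set.subset_compl_iff_disjoint_left.1 hAB) 0 m

/-- Campbell's formula outside a set `B`, on the event that `B` contains a point. -/
theorem setLIntegral_exists_tsum (h : IsPoissonProcess Q lam) (hlam : 0 ≤ lam) {B : Set Plane}
    (hB : MeasurableSet B) (hB' : volume B ≠ ⊤) {f : Plane → ℝ≥0∞} (hf : Measurable f) :
    ∫⁻ x in {x | ∃ i, x i ∈ B}, ∑' i, Bᶜ.indicator f (x i) ∂Q =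
      Q {x | ∃ i, x i ∈ B} * (ENNReal.ofReal lam * ∫⁻ z in Bᶜ, f z) := by
  have := h.prob
  have hE : {x : ℕ → Plane | ∃ i, x i ∈ B} =
      {x | {i | x i ∈ B}.encard = ((0 : ℕ) : ℕ∞)}ᶜ := by
    ext x
    rw [Set.mem_compl_iff, Set.mem_ofPred_eq, Set.mem_ofPred_eq, ← forall_notMem_eq]
    push Not
    rfl
  rw [hE]
  have hm0 := measurableSet_encard_eq hB 0
  refine h.setLIntegral_tsum_of_indep hlam hB.compl ?_ hf
  intro A hA hA' hAB m
  have h1 := h.count_eq_and_count_eq hB hB' hA hA' (Set.subset_compl_iff_disjoint_left.1 hAB) 0 m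
  rw [Set.inter_comm, ← Set.sdiff_eq, ← Set.sdiff_inter_self_eq_sdiff,
    measure_sdiff Set.inter_subset_right
      (hm0.inter (measurableSet_encard_eq hA m)).nullMeasurableSet (measure_ne_top _ _), h1,
    measure_compl hm0 (measure_ne_top _ _), measure_univ,
    ENNReal.sub_mul (fun _ _ => measure_ne_top _ _), one_mul]

end IsPoissonProcess

/-! ### Measurability of the network quantities -/

section Measurability

variable {Ω κ : Type*} [MeasurableSpace Ω] [Countable κ]

theorem measurableSet_assoc {x : Ω → κ → Plane} (hx : ∀ k, Measurable fun ω => x ω k)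
    {z : Ω → Plane} (hz : Measurable z) (i : κ) : MeasurableSet {ω | Assoc (x ω) i (z ω)} := by
  simp only [Assoc]
  rw [Set.ofPred_forall]
  exact MeasurableSet.iInter fun k => measurableSet_le (hz.dist (hx i)) (hz.dist (hx k))

theorem measurableSet_scheduled {x : Ω → κ → Plane} (hx : ∀ k, Measurable fun ω => x ω k)
    {y : Ω → ℕ → Plane} (hy : Measurable y) {u : Ω → ℕ → unitInterval} (hu : Measurable u)
    (i : κ) (j : ℕ) : MeasurableSet {ω | Scheduled (x ω) (y ω) (u ω) i j} := by
  have hy' := fun j => (measurable_pi_apply j).comp hy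
  have hu' := fun j => (measurable_pi_apply j).comp hu
  refine (measurableSet_assoc hx (hy' j) i).inter ?_
  change MeasurableSet {ω | ∀ k, Assoc (x ω) i (y ω k) → u ω j ≤ u ω k}
  rw [Set.ofPred_forall]
  refine MeasurableSet.iInter fun k => ?_
  exact (measurableSet_assoc hx (hy' k) i).himp (measurableSet_le
    (measurable_subtype_coe.comp (hu' j)) (measurable_subtype_coe.comp (hu' k)))

theorem measurableSet_inBeam (θ : ℝ) {a b z : Ω → Plane} (ha : Measurable a) (hb : Measurable b)
    (hz : Measurable z) : MeasurableSet {ω | InBeam θ (a ω) (b ω) (z ω)} := by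
  unfold InBeam InnerProductGeometry.angle
  refine measurableSet_le (Real.continuous_arccos.measurable.comp ?_) measurable_const
  fun_prop

theorem measurable_pathGain (α R : ℝ) : Measurable (pathGain α R) := by
  unfold pathGain
  exact Measurable.ite measurableSet_Iic (by fun_prop) measurable_const

theorem measurable_withOrigin {x : Ω → ℕ → Plane} (hx : Measurable x) (k : Option ℕ) :
    Measurable fun ω => withOrigin (x ω) k := by
  cases k with
  | none => exact measurable_const
  | some k => exact (measurable_pi_apply k).comp hx

variable {x y : Ω → ℕ → Plane} {u : Ω → ℕ → unitInterval} {g : Ω → ℕ → ℝ} {h : Ω → ℝ}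

theorem measurable_dlInterference (α θ R P : ℝ) (hx : Measurable x) (hy : Measurable y)
    (hu : Measurable u) (hg : Measurable g) :
    Measurable fun ω => dlInterference α θ R P (x ω) (y ω) (u ω) (g ω) := by
  have hx' := fun j => (measurable_pi_apply j).comp hx
  have hy' := fun j => (measurable_pi_apply j).comp hy
  refine Measurable.tsum fun i => Measurable.ite ?_ ?_ measurable_const
  · refine (measurableSet_assoc hx' measurable_const i).compl.inter ?_
    change MeasurableSet {ω | ∃ j, Scheduled (x ω) (y ω) (u ω) i j ∧ InBeam θ (x ω i) (y ω j) 0}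
    rw [Set.ofPred_exists]
    exact MeasurableSet.iUnion fun j => (measurableSet_scheduled hx' hy hu i j).inter
      (measurableSet_inBeam θ (hx' i) (hy' j) measurable_const)
  · exact ((((measurable_pi_apply i).comp hg).const_mul P).mul
      ((measurable_pathGain α R).comp (hx' i).norm)).ennreal_ofReal

theorem measurable_ulInterference (α θ R P : ℝ) (hx : Measurable x) (hy : Measurable y)
    (hu : Measurable u) (hg : Measurable g) :
    Measurable fun ω => ulInterference α θ R P (x ω) (y ω) (u ω) (g ω) := by
  have hx' := fun j => (measurable_pi_apply j).comp hx
  have hy' := fun j => (measurable_pi_apply j).comp hy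
  refine Measurable.tsum fun j => Measurable.ite ?_ ?_ measurable_const
  · rw [Set.ofPred_exists]
    exact MeasurableSet.iUnion fun i =>
      (measurableSet_scheduled (measurable_withOrigin hx) hy hu (some i) j).inter
      (measurableSet_inBeam θ (hy' j) (hx' i) measurable_const)
  · exact ((((measurable_pi_apply j).comp hg).const_mul P).mul
      ((measurable_pathGain α R).comp (hy' j).norm)).ennreal_ofReal

theorem measurable_ulSignal (α R P : ℝ) (hx : Measurable x) (hy : Measurable y)
    (hu : Measurable u) (hh : Measurable h) :
    Measurable fun ω => ulSignal α R P (x ω) (y ω) (u ω) (h ω) := by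
  have hy' := fun j => (measurable_pi_apply j).comp hy
  refine Measurable.tsum fun j => Measurable.ite
    (measurableSet_scheduled (measurable_withOrigin hx) hy hu none j) ?_ measurable_const
  exact ((hh.const_mul P).mul ((measurable_pathGain α R).comp (hy' j).norm)).ennreal_ofReal

theorem measurableSet_originActive (hx : Measurable x) (hy : Measurable y) (hu : Measurable u) :
    MeasurableSet {ω | OriginActive (x ω) (y ω) (u ω)} := by
  simp only [OriginActive]
  rw [Set.ofPred_exists]
  exact MeasurableSet.iUnion fun j =>
    measurableSet_scheduled (measurable_withOrigin hx) hy hu none j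

theorem measurable_iInf_norm : Measurable fun x : ℕ → Plane => ⨅ i, ‖x i‖ :=
  Measurable.iInf fun i => (measurable_pi_apply i).norm

end Measurability

theorem measurable_dlCapacity (α θ R P N : ℝ) : Measurable (dlCapacity α θ R P N) := by
  unfold dlCapacity dlSINR
  refine Real.measurable_log.comp (measurable_const.add (Measurable.ennreal_toReal
    (Measurable.div ?_ (Measurable.add ?_ measurable_const))))
  · exact ((measurable_const.mul (by fun_prop)).mul ((measurable_pathGain α R).comp
      (measurable_iInf_norm.comp measurable_fst))).ennreal_ofReal
  · exact measurable_dlInterference α θ R P (by fun_prop) (by fun_prop) (by fun_prop) (by fun_prop)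

theorem measurable_ulCapacity (α θ R P N : ℝ) : Measurable (ulCapacity α θ R P N) := by
  unfold ulCapacity ulSINR
  refine Real.measurable_log.comp (measurable_const.add (Measurable.ennreal_toReal
    (Measurable.div ?_ (Measurable.add ?_ measurable_const))))
  · exact measurable_ulSignal α R P (by fun_prop) (by fun_prop) (by fun_prop) (by fun_prop)
  · exact measurable_ulInterference α θ R P (by fun_prop) (by fun_prop) (by fun_prop) (by fun_prop)

/-! ### Fading and the law of the network -/

instance : IsProbabilityMeasure (expMeasure 1) := isProbabilityMeasure_expMeasure one_pos

theorem lintegral_expMeasure_one : ∫⁻ h, ENNReal.ofReal h ∂(expMeasure 1) = 1 := by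
  -- `t` times the density of the exponential law is the density of the Gamma law of shape `2`.
  have hm : Measurable (gammaPDF 1 1) := (measurable_gammaPDFReal 1 1).ennreal_ofReal
  rw [expMeasure, gammaMeasure,
    lintegral_withDensity_eq_lintegral_mul _ hm ENNReal.measurable_ofReal,
    ← lintegral_gammaPDF_eq_one (a := 2) (r := 1) two_pos one_pos]
  refine lintegral_congr fun t => ?_
  rcases le_or_gt 0 t with ht | ht
  · rw [Pi.mul_apply, gammaPDF_of_nonneg ht, gammaPDF_of_nonneg ht, ← ENNReal.ofReal_mul' ht]
    congr 1
    have h2 : Real.Gamma 2 = 1 := by simp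
    norm_num [h2]
    ring
  · rw [Pi.mul_apply, gammaPDF_of_neg ht, gammaPDF_of_neg ht, zero_mul]

theorem expMeasure_one_Iic_le {δ : ℝ} (hδ : 0 ≤ δ) :
    expMeasure 1 (Set.Iic δ) ≤ ENNReal.ofReal δ := by
  have h := cdf_expMeasure_eq one_pos δ
  rw [if_pos hδ, cdf_eq_real, measureReal_def] at h
  rw [← ENNReal.ofReal_toReal (measure_ne_top _ (Set.Iic δ)), h]
  refine ENNReal.ofReal_le_ofReal ?_
  linarith [Real.add_one_le_exp (-(1 * δ))]

/-- The law of the scheduling marks. -/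
def marksLaw : Measure (ℕ → unitInterval) :=
  Measure.infinitePi fun _ : ℕ => (volume : Measure unitInterval)

/-- The law of the fading powers of the interfering links. -/
def fadingLaw : Measure (ℕ → ℝ) := Measure.infinitePi fun _ : ℕ => expMeasure 1

instance : IsProbabilityMeasure marksLaw := by unfold marksLaw; infer_instance

instance : IsProbabilityMeasure fadingLaw := by unfold fadingLaw; infer_instance

theorem lintegral_fadingLaw_eval (P : ℝ) (hP : 0 ≤ P) (i : ℕ) :
    ∫⁻ g, ENNReal.ofReal (P * g i) ∂fadingLaw = ENNReal.ofReal P := by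
  have h := measurePreserving_eval_infinitePi (fun _ : ℕ => expMeasure 1) i
  have h2 := h.lintegral_comp (f := fun t => ENNReal.ofReal (P * t)) (by fun_prop)
  refine h2.trans ?_
  simp_rw [ENNReal.ofReal_mul hP]
  rw [lintegral_const_mul _ ENNReal.measurable_ofReal, lintegral_expMeasure_one, mul_one]

theorem lintegral_networkLaw {QB QU : Measure (ℕ → Plane)} [IsProbabilityMeasure QB]
    [IsProbabilityMeasure QU] {F : Sample → ℝ≥0∞} (hF : Measurable F) :
    ∫⁻ s, F s ∂(networkLaw QB QU) = ∫⁻ x, ∫⁻ y, ∫⁻ u, ∫⁻ h, ∫⁻ g, F (x, y, u, h, g)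
      ∂fadingLaw ∂(expMeasure 1) ∂marksLaw ∂QU ∂QB := by
  change ∫⁻ s, F s ∂(QB.prod (QU.prod (marksLaw.prod ((expMeasure 1).prod fadingLaw)))) = _
  rw [lintegral_prod _ hF.aemeasurable]
  refine lintegral_congr fun x => ?_
  rw [lintegral_prod _ (by fun_prop)]
  refine lintegral_congr fun y => ?_
  rw [lintegral_prod _ (by fun_prop)]
  refine lintegral_congr fun u => ?_
  rw [lintegral_prod _ (by fun_prop)]

instance {QB QU : Measure (ℕ → Plane)} [IsProbabilityMeasure QB] [IsProbabilityMeasure QU] :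
    IsProbabilityMeasure (networkLaw QB QU) := by
  change IsProbabilityMeasure (QB.prod (QU.prod (marksLaw.prod ((expMeasure 1).prod fadingLaw))))
  infer_instance

/-! ### Bounds for the capacity of a link -/

theorem pathGain_nonneg (α R : ℝ) {r : ℝ} (hr : 0 ≤ r) : 0 ≤ pathGain α R r := by
  unfold pathGain; split_ifs
  exacts [Real.rpow_nonneg hr _, le_rfl]

theorem pathGain_le (α R : ℝ) {r : ℝ} (hr : 0 ≤ r) : pathGain α R r ≤ r ^ (-α) := by
  unfold pathGain; split_ifs
  exacts [le_rfl, Real.rpow_nonneg hr _]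

open Classical in
/-- A bound for the logarithm of the path gain at distance `r`, with `lam` the BS density:
the first term is the leading one, the second one accounts for the links which are shorter than the
typical distance `lam ^ (-1/2)` of the nearest BS. -/
def logGainBound (α R lam r : ℝ) : ℝ :=
  (if r ≤ R then α / 2 * Real.posLog lam else 0) +
    (if r ≤ (√lam)⁻¹ then α * (√lam)⁻¹ * r⁻¹ else 0)

theorem logGainBound_nonneg {α R lam r : ℝ} (hα : 0 ≤ α) (hr : 0 ≤ r) :
    0 ≤ logGainBound α R lam r := by
  unfold logGainBound
  have := Real.posLog_nonneg (x := lam)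
  split_ifs <;> positivity

/-- The bound for the capacity of a link without interference: `a` is the fading power times the
ratio of the transmission power to the noise power. -/
theorem log_one_add_mul_pathGain_le {α R lam r a : ℝ} (hα : 0 < α) (hlam : 0 < lam) (hr : 0 ≤ r)
    (ha : 0 ≤ a) : Real.log (1 + a * pathGain α R r) ≤ a + logGainBound α R lam r := by
  have hw := logGainBound_nonneg (R := R) (lam := lam) hα.le hr
  have hzero : pathGain α R r = 0 → Real.log (1 + a * pathGain α R r) ≤
      a + logGainBound α R lam r := by
    intro h; rw [h]; simp; linarith
  rcases hr.eq_or_lt with rfl | hr0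
  · -- `0 ^ (-α) = 0` by convention, so that a link of length `0` has gain `0`.
    refine hzero ?_
    unfold pathGain; split_ifs
    exacts [Real.zero_rpow (by linarith), rfl]
  by_cases hrR : r ≤ R
  swap
  · exact hzero (if_neg hrR)
  have hs : 0 < √lam := Real.sqrt_pos.2 hlam
  have hpos : 0 < r ^ (-α) := Real.rpow_pos_of_pos hr0 _
  have h1 : Real.log (1 + a * r ^ (-α)) ≤ a + Real.posLog (r ^ (-α)) := by
    have hm : 1 + a * r ^ (-α) ≤ (1 + a) * max 1 (r ^ (-α)) := by
      nlinarith [le_max_left 1 (r ^ (-α)), le_max_right 1 (r ^ (-α))]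
    calc Real.log (1 + a * r ^ (-α)) ≤ Real.log ((1 + a) * max 1 (r ^ (-α))) :=
          Real.log_le_log (by positivity) hm
      _ = Real.log (1 + a) + Real.log (max 1 (r ^ (-α))) :=
          Real.log_mul (by positivity) (by positivity)
      _ ≤ a + Real.posLog (r ^ (-α)) := by
          refine add_le_add ?_ ?_
          · linarith [Real.log_le_sub_one_of_pos (show 0 < 1 + a by linarith)]
          · rw [Real.posLog_eq_log_max_one hpos.le]
  have h2 : Real.log (r ^ (-α)) = α * (1 / 2 * Real.log lam + Real.log ((√lam)⁻¹ * r⁻¹)) := by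
    rw [Real.log_rpow hr0, ← mul_inv, Real.log_inv, Real.log_mul hs.ne' hr0.ne',
      Real.log_sqrt hlam.le]
    ring
  have h3 : Real.log ((√lam)⁻¹ * r⁻¹) ≤ if r ≤ (√lam)⁻¹ then (√lam)⁻¹ * r⁻¹ else 0 := by
    split_ifs with hc
    · have : 0 < (√lam)⁻¹ * r⁻¹ := by positivity
      linarith [Real.log_le_sub_one_of_pos this]
    · refine Real.log_nonpos (by positivity) ?_
      rw [← div_eq_mul_inv, div_le_one hr0]
      exact (not_le.1 hc).le
  have h4 : 0 ≤ if r ≤ (√lam)⁻¹ then (√lam)⁻¹ * r⁻¹ else 0 := by split_ifs <;> positivity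
  have h5 : Real.posLog (r ^ (-α)) ≤ logGainBound α R lam r := by
    have h6 : logGainBound α R lam r = α * (1 / 2 * Real.posLog lam +
        if r ≤ (√lam)⁻¹ then (√lam)⁻¹ * r⁻¹ else 0) := by
      unfold logGainBound
      rw [if_pos hrR]
      split_ifs <;> ring
    rw [Real.posLog]
    refine max_le hw ?_
    rw [h2, h6]
    have : Real.log lam ≤ Real.posLog lam := le_max_right _ _
    gcongr
  rw [pathGain, if_pos hrR]
  linarith

theorem measurable_logGainBound (α R lam : ℝ) : Measurable (logGainBound α R lam) := by
  unfold logGainBound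
  exact (Measurable.ite measurableSet_Iic measurable_const measurable_const).add
    (Measurable.ite measurableSet_Iic (by fun_prop) measurable_const)

/-! ### Poisson processes and discs -/

namespace IsPoissonProcess

variable {Q : Measure (ℕ → Plane)} {lam : ℝ}

theorem void_closedBall (h : IsPoissonProcess Q lam) (hlam : 0 ≤ lam) (z : Plane) {r : ℝ}
    (hr : 0 ≤ r) : Q {x | ∀ i, x i ∉ Metric.closedBall z r} =
      ENNReal.ofReal (Real.exp (-(lam * Real.pi * r ^ 2))) := by
  rw [h.void hlam Metric.isClosed_closedBall.measurableSet
    Metric.isBounded_closedBall.measure_lt_top.ne]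
  simp only [EuclideanSpace.volume_closedBall_fin_two, ENNReal.toReal_mul, ENNReal.toReal_pow,
    ENNReal.toReal_ofReal hr, ENNReal.toReal_ofReal Real.pi_pos.le]
  congr 3
  ring

theorem void_ball (h : IsPoissonProcess Q lam) (hlam : 0 ≤ lam) (z : Plane) {r : ℝ}
    (hr : 0 ≤ r) : Q {x | ∀ i, x i ∉ Metric.ball z r} =
      ENNReal.ofReal (Real.exp (-(lam * Real.pi * r ^ 2))) := by
  rw [h.void hlam Metric.isOpen_ball.measurableSet Metric.isBounded_ball.measure_lt_top.ne]
  simp only [EuclideanSpace.volume_ball_fin_two, ENNReal.toReal_mul, ENNReal.toReal_pow,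
    ENNReal.toReal_ofReal hr, ENNReal.toReal_ofReal Real.pi_pos.le]
  congr 3
  ring

theorem measurableSet_void {B : Set Plane} (hB : MeasurableSet B) :
    MeasurableSet {x : ℕ → Plane | ∀ i, x i ∉ B} := by
  rw [Set.ofPred_forall]
  exact MeasurableSet.iInter fun i => (measurable_pi_apply i hB).compl

theorem measurableSet_exists_mem {B : Set Plane} (hB : MeasurableSet B) :
    MeasurableSet {x : ℕ → Plane | ∃ i, x i ∈ B} := by
  rw [Set.ofPred_exists]
  exact MeasurableSet.iUnion fun i => measurable_pi_apply i hB

theorem exists_mem_closedBall (h : IsPoissonProcess Q lam) (hlam : 0 ≤ lam) (z : Plane) {r : ℝ}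
    (hr : 0 ≤ r) : Q {x | ∃ i, x i ∈ Metric.closedBall z r} =
      ENNReal.ofReal (1 - Real.exp (-(lam * Real.pi * r ^ 2))) := by
  have := h.prob
  have hE : {x : ℕ → Plane | ∃ i, x i ∈ Metric.closedBall z r} =
      {x | ∀ i, x i ∉ Metric.closedBall z r}ᶜ := by
    ext x; simp
  rw [hE, measure_compl (measurableSet_void Metric.isClosed_closedBall.measurableSet)
    (measure_ne_top _ _), h.void_closedBall hlam z hr, measure_univ,
    ENNReal.ofReal_sub _ (Real.exp_pos _).le, ENNReal.ofReal_one]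

/-- Markov's inequality for the number of points in `B`. -/
theorem exists_mem_le (h : IsPoissonProcess Q lam) (hlam : 0 ≤ lam) {B : Set Plane}
    (hB : MeasurableSet B) :
    Q {x | ∃ i, x i ∈ B} ≤ ENNReal.ofReal lam * volume B := by
  have h1 := h.campbell hlam (f := B.indicator 1) (measurable_one.indicator hB)
  rw [lintegral_indicator_one hB] at h1
  rw [← h1, Set.ofPred_exists]
  refine (measure_iUnion_le _).trans ?_
  rw [lintegral_tsum (f := fun i (x : ℕ → Plane) => B.indicator 1 (x i)) fun i =>
    ((measurable_one.indicator hB).comp (measurable_pi_apply i)).aemeasurable]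
  refine ENNReal.tsum_le_tsum fun i => ?_
  exact (lintegral_indicator_one (μ := Q) (measurable_pi_apply (X := fun _ : ℕ => Plane) i hB)).ge

theorem ae_notMem (h : IsPoissonProcess Q lam) (hlam : 0 ≤ lam) {B : Set Plane}
    (hB : MeasurableSet B) (hB0 : volume B = 0) : ∀ᵐ x ∂Q, ∀ i, x i ∉ B := by
  have := h.exists_mem_le hlam hB
  rw [hB0, mul_zero, nonpos_iff_eq_zero] at this
  rw [ae_iff]
  simpa using this

/-- A point nearest to the origin exists, since discs contain finitely many points. -/
theorem ae_exists_norm_eq_iInf (h : IsPoissonProcess Q lam) (hlam : 0 ≤ lam) :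
    ∀ᵐ x ∂Q, ∃ i, x i ≠ 0 ∧ (⨅ k, ‖x k‖) = ‖x i‖ := by
  have h1 : ∀ᵐ x ∂Q, ∀ n : ℕ, {i | x i ∈ Metric.closedBall (0 : Plane) n}.Finite :=
    ae_all_iff.2 fun n => h.ae_finite_setOf_mem Metric.isClosed_closedBall.measurableSet
      Metric.isBounded_closedBall.measure_lt_top.ne
  filter_upwards [h1, h.ae_notMem hlam (measurableSet_singleton 0) (by simp)] with x hx hx0
  obtain ⟨n, hn⟩ := exists_nat_ge ‖x 0‖
  obtain ⟨i, hi, hmin⟩ := Set.exists_min_image _ (fun i => ‖x i‖) (hx n) ⟨0, by simpa using hn⟩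
  have hbdd : BddBelow (Set.range fun k => ‖x k‖) := ⟨0, by rintro _ ⟨k, rfl⟩; positivity⟩
  refine ⟨i, hx0 i, le_antisymm (ciInf_le hbdd i) (le_ciInf fun k => ?_)⟩
  by_cases hk : x k ∈ Metric.closedBall (0 : Plane) n
  · exact hmin k hk
  · simp only [Set.mem_ofPred_eq, Metric.mem_closedBall, dist_zero_right, not_le] at hi hk
    linarith

/-- Almost surely one point is nearest to `z`. This bound for the mean number of nearest points
needs no argument about ties: the nearest points lie in the first of the concentric annuli of area
`1 / lam` that is not empty. -/
theorem lintegral_tsum_assoc_le (h : IsPoissonProcess Q lam) (hlam : 0 < lam) (z : Plane) :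
    ∫⁻ x, ∑' i, {x | Assoc x i z}.indicator 1 x ∂Q ≤ 2 := by
  have hpi := Real.pi_pos
  let ρ : ℕ → ℝ := fun m => √(m / (lam * Real.pi))
  have hρ : ∀ m, 0 ≤ ρ m := fun m => Real.sqrt_nonneg _
  have hρ2 : ∀ m, lam * Real.pi * ρ m ^ 2 = m := fun m => by
    rw [Real.sq_sqrt (by positivity)]; field_simp
  have hρ3 : ∀ (m : ℕ) (d : ℝ), 0 ≤ d → (d < ρ m ↔ lam * Real.pi * d ^ 2 < m) := fun m d hd => by
    rw [Real.lt_sqrt hd, lt_div_iff₀ (by positivity), mul_comm]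
  let A : ℕ → Set Plane := fun m => Metric.ball z (ρ m)
  have hA : ∀ m, MeasurableSet (A m) := fun m => Metric.isOpen_ball.measurableSet
  have hA' : ∀ m, volume (A m) = ENNReal.ofReal (m / lam) := fun m => by
    rw [EuclideanSpace.volume_ball_fin_two, ← ENNReal.ofReal_pow (hρ m),
      ← ENNReal.ofReal_mul (by positivity)]
    congr 1
    have := hρ2 m
    field_simp
    linarith
  let f : ℕ → Plane → ℝ≥0∞ := fun m => (A m)ᶜ.indicator ((A (m + 1)).indicator 1)
  have hf : ∀ m, Measurable (f m) := fun m =>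
    (measurable_one.indicator (hA (m + 1))).indicator (hA m).compl
  have hF : ∀ m, Measurable fun x : ℕ → Plane => ∑' i, f m (x i) := fun m =>
    Measurable.tsum fun i => (hf m).comp (measurable_pi_apply i)
  have hpt : ∀ x : ℕ → Plane, ∑' i, {x | Assoc x i z}.indicator (1 : (ℕ → Plane) → ℝ≥0∞) x ≤
      ∑' m : ℕ, {x : ℕ → Plane | ∀ i, x i ∉ A m}.indicator (fun x => ∑' i, f m (x i)) x := by
    intro x
    have h1 : ∀ i, {x | Assoc x i z}.indicator (1 : (ℕ → Plane) → ℝ≥0∞) x ≤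
        ∑' m : ℕ, {x : ℕ → Plane | ∀ i, x i ∉ A m}.indicator (fun x => f m (x i)) x := by
      intro i
      by_cases hx : Assoc x i z
      swap
      · simp [hx]
      let m := ⌊lam * Real.pi * dist z (x i) ^ 2⌋₊
      have hm1 : x i ∈ A (m + 1) := by
        rw [Metric.mem_ball, dist_comm, hρ3 _ _ dist_nonneg]
        exact_mod_cast Nat.lt_floor_add_one _
      have hm2 : ∀ k, x k ∉ A m := by
        intro k hk
        rw [Metric.mem_ball, dist_comm] at hk
        have h2 := (hρ3 m _ dist_nonneg).1 ((hx k).trans_lt hk)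
        exact absurd (Nat.floor_le (by positivity)) (not_le.2 h2)
      refine le_trans ?_ (ENNReal.le_tsum m)
      rw [Set.indicator_of_mem (show x ∈ {x : ℕ → Plane | ∀ i, x i ∉ A m} from hm2)]
      simp only [f]
      rw [Set.indicator_of_mem (show x i ∈ (A m)ᶜ from hm2 i), Set.indicator_of_mem hm1,
        Set.indicator_of_mem (by exact hx)]
      simp
    refine (ENNReal.tsum_le_tsum h1).trans ?_
    rw [ENNReal.tsum_comm]
    refine ENNReal.tsum_le_tsum fun m => ?_
    by_cases hx : x ∈ {x : ℕ → Plane | ∀ i, x i ∉ A m}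
    · simp only [Set.indicator_of_mem hx, le_refl]
    · simp only [Set.indicator_of_notMem hx, tsum_zero, le_refl]
  have hm : ∀ m, MeasurableSet {x : ℕ → Plane | ∀ i, x i ∉ A m} := fun m =>
    measurableSet_void (hA m)
  refine ((lintegral_mono hpt).trans ?_).trans ENNReal.tsum_geometric_two.le
  rw [lintegral_tsum fun m => ((hF m).indicator (hm m)).aemeasurable]
  refine ENNReal.tsum_le_tsum fun m => ?_
  rw [lintegral_indicator (hm m), h.setLIntegral_void_tsum hlam.le (hA m) (by rw [hA' m]; simp)
    (measurable_one.indicator (hA (m + 1)))]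
  have h3 : ∫⁻ w in (A m)ᶜ, (A (m + 1)).indicator 1 w = ENNReal.ofReal (1 / lam) := by
    rw [lintegral_indicator_one (hA (m + 1)), Measure.restrict_apply (hA (m + 1)), ← Set.sdiff_eq,
      measure_sdiff _ (hA m).nullMeasurableSet (by rw [hA' m]; simp), hA', hA',
      ← ENNReal.ofReal_sub _ (by positivity)]
    · congr 1; push_cast; ring
    · exact Metric.ball_subset_ball (Real.sqrt_le_sqrt (by gcongr; simp))
  rw [h3, ← ENNReal.ofReal_mul hlam.le, mul_one_div_cancel hlam.ne', ENNReal.ofReal_one, mul_one,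
    h.void_ball hlam.le z (hρ m), hρ2 m]
  -- Each annulus contributes one point on average, on an event of probability `e⁻ᵐ ≤ 2⁻ᵐ`.
  have h4 : (2⁻¹ : ℝ≥0∞) ^ m = ENNReal.ofReal ((1 / 2) ^ m) := by
    rw [ENNReal.ofReal_pow (by norm_num), ENNReal.ofReal_div_of_pos two_pos]
    simp
  rw [h4]
  refine ENNReal.ofReal_le_ofReal ?_
  rw [show -(m : ℝ) = m * (-1) by ring, Real.exp_nat_mul]
  refine pow_le_pow_left₀ (Real.exp_pos _).le ?_ m
  rw [Real.exp_neg, ← one_div]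
  exact one_div_le_one_div_of_le two_pos (by linarith [Real.add_one_le_exp (1 : ℝ)])

end IsPoissonProcess

/-! ### Averages over independent processes -/

/-- The mean of a sum over users of a function that also depends on the BSs. -/
theorem lintegral_lintegral_tsum {QB QU : Measure (ℕ → Plane)} [SFinite QB] {lamU : ℝ}
    (hQU : IsPoissonProcess QU lamU) (hU : 0 ≤ lamU) {F : (ℕ → Plane) → Plane → ℝ≥0∞}
    (hF : Measurable (Function.uncurry F)) :
    ∫⁻ x, ∫⁻ y, ∑' j, F x (y j) ∂QU ∂QB = ENNReal.ofReal lamU * ∫⁻ z, ∫⁻ x, F x z ∂QB := by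
  have h1 : ∀ x, ∫⁻ y, ∑' j, F x (y j) ∂QU = ENNReal.ofReal lamU * ∫⁻ z, F x z := fun x =>
    hQU.campbell hU (by fun_prop)
  simp_rw [h1]
  rw [lintegral_const_mul _ (by fun_prop), lintegral_lintegral_swap hF.aemeasurable]

/-- `logGainBound` as a function on the plane: a constant on the disc of radius `R`, plus an
integrable singularity at the origin. -/
theorem ofReal_logGainBound (α R lam : ℝ) (hα : 0 ≤ α) (z : Plane) :
    ENNReal.ofReal (logGainBound α R lam ‖z‖) =
      (Metric.closedBall (0 : Plane) R).indicator
        (fun _ => ENNReal.ofReal (α / 2 * Real.posLog lam)) z +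
      (Metric.closedBall (0 : Plane) (√lam)⁻¹).indicator
        (fun z => ENNReal.ofReal (α * (√lam)⁻¹) * ENNReal.ofReal ‖z‖⁻¹) z := by
  have := Real.posLog_nonneg (x := lam)
  unfold logGainBound
  rw [ENNReal.ofReal_add (by split_ifs <;> positivity) (by split_ifs <;> positivity)]
  congr 1
  · simp only [Set.indicator, mem_closedBall_zero_iff]
    split_ifs <;> simp
  · simp only [Set.indicator, mem_closedBall_zero_iff]
    split_ifs
    · rw [ENNReal.ofReal_mul (by positivity)]
    · simp

theorem lintegral_logGainBound_near {α lam : ℝ} (hα : 0 ≤ α) (hlam : 0 < lam) :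
    ∫⁻ z : Plane, (Metric.closedBall (0 : Plane) (√lam)⁻¹).indicator
        (fun z => ENNReal.ofReal (α * (√lam)⁻¹) * ENNReal.ofReal ‖z‖⁻¹) z =
      ENNReal.ofReal (2 * Real.pi * α / lam) := by
  rw [lintegral_indicator Metric.isClosed_closedBall.measurableSet, lintegral_const_mul _
    (by fun_prop), setLIntegral_inv_norm_closedBall (by positivity),
    ← ENNReal.ofReal_mul (by positivity)]
  congr 1
  have : √lam ≠ 0 := (Real.sqrt_pos.2 hlam).ne'
  rw [← Real.sq_sqrt hlam.le]
  field_simp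
  simp [Real.sqrt_sq (Real.sqrt_nonneg _)]

theorem measurePreserving_bs (QB QU : Measure (ℕ → Plane)) [IsProbabilityMeasure QU] :
    MeasurePreserving (fun s : Sample => s.1) (networkLaw QB QU) QB :=
  measurePreserving_fst (ν := QU.prod (marksLaw.prod ((expMeasure 1).prod fadingLaw)))

section Marginals

variable (QB QU : Measure (ℕ → Plane)) [IsProbabilityMeasure QB] [IsProbabilityMeasure QU]

theorem measurePreserving_users :
    MeasurePreserving (fun s : Sample => s.2.1) (networkLaw QB QU) QU :=
  (measurePreserving_fst (μ := QU) (ν := marksLaw.prod ((expMeasure 1).prod fadingLaw))).comp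
    (measurePreserving_snd (μ := QB))

theorem measurePreserving_bs_users :
    MeasurePreserving (fun s : Sample => (s.1, s.2.1)) (networkLaw QB QU) (QB.prod QU) :=
  (MeasurePreserving.id QB).prod
    (measurePreserving_fst (μ := QU) (ν := marksLaw.prod ((expMeasure 1).prod fadingLaw)))

theorem measurePreserving_fading :
    MeasurePreserving (fun s : Sample => s.2.2.2.1) (networkLaw QB QU) (expMeasure 1) :=
  (measurePreserving_fst (μ := expMeasure 1) (ν := fadingLaw)).comp
    ((measurePreserving_snd (μ := marksLaw)).comp
      ((measurePreserving_snd (μ := QU)).comp (measurePreserving_snd (μ := QB))))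

end Marginals

/-! ### Elementary bounds for the SINR -/

theorem toReal_div_add_le {a N : ℝ} (ha : 0 ≤ a) (hN : 0 < N) (I : ℝ≥0∞) :
    (ENNReal.ofReal a / (I + ENNReal.ofReal N)).toReal ≤ a / N := by
  have h1 : ENNReal.ofReal a / (I + ENNReal.ofReal N) ≤ ENNReal.ofReal (a / N) := by
    rw [ENNReal.ofReal_div_of_pos hN]
    exact ENNReal.div_le_div_left le_add_self _
  exact ENNReal.toReal_le_of_le_ofReal (by positivity) h1

theorem le_toReal_div_add {a N T : ℝ} (hN : 0 < N) (hT : 0 ≤ T) {S I : ℝ≥0∞}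
    (hS : S ≠ ⊤) (haS : ENNReal.ofReal a ≤ S) (hI : I ≤ ENNReal.ofReal T) :
    a / (T + N) ≤ (S / (I + ENNReal.ofReal N)).toReal := by
  have h1 : ENNReal.ofReal (a / (T + N)) ≤ S / (I + ENNReal.ofReal N) := by
    rw [ENNReal.ofReal_div_of_pos (by positivity), ENNReal.ofReal_add hT hN.le]
    exact ENNReal.div_le_div haS (by gcongr)
  refine (ENNReal.ofReal_le_iff_le_toReal ?_).1 h1
  exact ENNReal.div_ne_top hS (by simp [hN])

theorem dlCapacity_nonneg (α θ R P N : ℝ) (s : Sample) : 0 ≤ dlCapacity α θ R P N s :=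
  Real.log_nonneg (le_add_of_nonneg_right ENNReal.toReal_nonneg)

theorem ulCapacity_nonneg (α θ R P N : ℝ) (s : Sample) : 0 ≤ ulCapacity α θ R P N s :=
  Real.log_nonneg (le_add_of_nonneg_right ENNReal.toReal_nonneg)

/-! ### Downlink: upper bound -/

/-- The fading power is truncated at `0` since it is positive only almost surely. -/
theorem dlCapacity_le {α θ R P N lam : ℝ} (hα : 0 < α) (hP : 0 < P) (hN : 0 < N) (hlam : 0 < lam)
    (s : Sample) : dlCapacity α θ R P N s ≤
      P / N * max s.2.2.2.1 0 + logGainBound α R lam (⨅ i, ‖s.1 i‖) := by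
  obtain ⟨x, y, u, h, g⟩ := s
  have hr : 0 ≤ ⨅ i, ‖x i‖ := Real.iInf_nonneg fun i => norm_nonneg _
  have hp := pathGain_nonneg α R hr
  refine le_trans ?_ (log_one_add_mul_pathGain_le hα hlam hr (by positivity))
  refine Real.log_le_log (by unfold dlSINR; positivity) ?_
  gcongr
  have h1 : ENNReal.ofReal (P * h * pathGain α R (⨅ i, ‖x i‖)) ≤
      ENNReal.ofReal (P * max h 0 * pathGain α R (⨅ i, ‖x i‖)) :=
    ENNReal.ofReal_le_ofReal (by gcongr; exact le_max_left _ _)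
  calc dlSINR α θ R P N x y u h g ≤ _ := ENNReal.toReal_mono
        (ENNReal.div_ne_top ENNReal.ofReal_ne_top (by simp [hN])) (ENNReal.div_le_div_right h1 _)
    _ ≤ P * max h 0 * pathGain α R (⨅ i, ‖x i‖) / N := toReal_div_add_le (by positivity) hN _
    _ = _ := by ring

theorem lintegral_logGainBound_iInf_le {QB : Measure (ℕ → Plane)} {lam α R : ℝ}
    (h : IsPoissonProcess QB lam) (hlam : 0 < lam) (hα : 0 ≤ α) (hR : 0 ≤ R) :
    ∫⁻ x, ENNReal.ofReal (logGainBound α R lam (⨅ i, ‖x i‖)) ∂QB ≤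
      ENNReal.ofReal (α / 2 * Real.posLog lam * losProb lam R + 2 * Real.pi * α) := by
  have hpl := Real.posLog_nonneg (x := lam)
  have hE : MeasurableSet {x : ℕ → Plane | ∃ i, x i ∈ Metric.closedBall (0 : Plane) R} :=
    IsPoissonProcess.measurableSet_exists_mem Metric.isClosed_closedBall.measurableSet
  let f := (Metric.closedBall (0 : Plane) (√lam)⁻¹).indicator
        (fun z => ENNReal.ofReal (α * (√lam)⁻¹) * ENNReal.ofReal ‖z‖⁻¹)
  have hf : Measurable f := Measurable.indicator (by fun_prop)
    Metric.isClosed_closedBall.measurableSet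
  have h1 : ∀ᵐ x ∂QB, ENNReal.ofReal (logGainBound α R lam (⨅ i, ‖x i‖)) ≤
      {x : ℕ → Plane | ∃ i, x i ∈ Metric.closedBall (0 : Plane) R}.indicator
        (fun _ => ENNReal.ofReal (α / 2 * Real.posLog lam)) x + ∑' i, f (x i) := by
    -- The singular term at the nearest BS is at most its sum over all BSs.
    filter_upwards [h.ae_exists_norm_eq_iInf hlam.le] with x ⟨i, _, hi⟩
    rw [hi, ofReal_logGainBound _ _ _ hα]
    refine add_le_add ?_ (ENNReal.le_tsum i)
    by_cases hx : x i ∈ Metric.closedBall (0 : Plane) R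
    · rw [Set.indicator_of_mem hx, Set.indicator_of_mem]
      exact ⟨i, hx⟩
    · rw [Set.indicator_of_notMem hx]
      exact zero_le
  refine (lintegral_mono_ae h1).trans ?_
  rw [lintegral_add_left (measurable_const.indicator hE), lintegral_indicator_const hE,
    h.exists_mem_closedBall hlam.le 0 hR, h.campbell hlam.le hf,
    lintegral_logGainBound_near hα hlam, ← ENNReal.ofReal_mul (by positivity),
    ← ENNReal.ofReal_mul (by positivity), ← ENNReal.ofReal_add]
  · refine ENNReal.ofReal_le_ofReal (le_of_eq ?_)
    unfold losProb
    field_simp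
  · have : Real.exp (-(lam * Real.pi * R ^ 2)) ≤ 1 := Real.exp_le_one_iff.2 (by
      have := Real.pi_pos; simp only [Left.neg_nonpos_iff]; positivity)
    have : 0 ≤ 1 - Real.exp (-(lam * Real.pi * R ^ 2)) := by linarith
    positivity
  · have := Real.pi_pos
    positivity

theorem losProb_nonneg {lam R : ℝ} (hlam : 0 ≤ lam) : 0 ≤ losProb lam R := by
  have : Real.exp (-(lam * Real.pi * R ^ 2)) ≤ 1 := Real.exp_le_one_iff.2 (by
      have := Real.pi_pos; simp only [Left.neg_nonpos_iff]; positivity)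
  unfold losProb; linarith

theorem lintegral_max_expMeasure : ∫⁻ h, ENNReal.ofReal (max h 0) ∂(expMeasure 1) = 1 := by
  rw [← lintegral_expMeasure_one]
  refine lintegral_congr fun h => ?_
  rcases le_total h 0 with h0 | h0
  · rw [max_eq_right h0, ENNReal.ofReal_of_nonpos h0, ENNReal.ofReal_zero]
  · rw [max_eq_left h0]

section Network

variable {QB QU : Measure (ℕ → Plane)} {lamM lamU : ℝ}

theorem lintegral_dlCapacity_le {α θ R P N : ℝ} (hα : 0 < α) (hP : 0 < P) (hN : 0 < N)
    (hR : 0 ≤ R) (hM : 0 < lamM) (hQB : IsPoissonProcess QB lamM) [IsProbabilityMeasure QU] :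
    ∫⁻ s, ENNReal.ofReal (dlCapacity α θ R P N s) ∂(networkLaw QB QU) ≤
      ENNReal.ofReal (α / 2 * Real.posLog lamM * losProb lamM R + (P / N + 2 * Real.pi * α)) := by
  have := hQB.prob
  have hpl := Real.posLog_nonneg (x := lamM)
  have hlos := losProb_nonneg (R := R) hM.le
  have hpi := Real.pi_pos
  have h1 : ∀ s : Sample, ENNReal.ofReal (dlCapacity α θ R P N s) ≤
      ENNReal.ofReal (P / N) * ENNReal.ofReal (max s.2.2.2.1 0) +
        ENNReal.ofReal (logGainBound α R lamM (⨅ i, ‖s.1 i‖)) := by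
    intro s
    rw [← ENNReal.ofReal_mul (by positivity), ← ENNReal.ofReal_add (by positivity)
      (logGainBound_nonneg hα.le (Real.iInf_nonneg fun i => norm_nonneg _))]
    exact ENNReal.ofReal_le_ofReal (dlCapacity_le hα hP hN hM s)
  refine (lintegral_mono h1).trans ?_
  have h2 : ∫⁻ s, ENNReal.ofReal (max s.2.2.2.1 0) ∂(networkLaw QB QU) = 1 := by
    rw [← lintegral_max_expMeasure]
    exact (measurePreserving_fading QB QU).lintegral_comp
      (f := fun h => ENNReal.ofReal (max h 0)) (by fun_prop)
  have h3 : ∫⁻ s, ENNReal.ofReal (logGainBound α R lamM (⨅ i, ‖s.1 i‖)) ∂(networkLaw QB QU) =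
      ∫⁻ x, ENNReal.ofReal (logGainBound α R lamM (⨅ i, ‖x i‖)) ∂QB :=
    (measurePreserving_bs QB QU).lintegral_comp
      (f := fun x => ENNReal.ofReal (logGainBound α R lamM (⨅ i, ‖x i‖)))
      ((measurable_logGainBound α R lamM).comp measurable_iInf_norm).ennreal_ofReal
  rw [lintegral_add_left (by fun_prop), lintegral_const_mul _ (by fun_prop), h2, h3, mul_one]
  refine (add_le_add_right (lintegral_logGainBound_iInf_le hQB hM hα.le hR) _).trans ?_
  rw [← ENNReal.ofReal_add (by positivity) (by positivity)]
  exact ENNReal.ofReal_le_ofReal (by linarith)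

/-! ### Downlink: the interference -/

/-- A bound for the downlink interference when no user is closer than `s` to the origin and every
user `y` has a BS within `‖y‖ / 2`: an active BS is then at least half as far from the origin as the
user that it serves. -/
def dlInterferenceBound (α P s : ℝ) (x y : ℕ → Plane) (g : ℕ → ℝ) : ℝ≥0∞ :=
  ∑' j, ∑' i, {x | Assoc x i (y j)}.indicator 1 x * (ENNReal.ofReal (P * g i) *
    (Metric.closedBall (0 : Plane) s)ᶜ.indicator
      (fun z => ENNReal.ofReal (2 ^ α) * ENNReal.ofReal (‖z‖ ^ (-α))) (y j))

theorem dlInterference_le {α θ R P s : ℝ} (hα : 0 < α) (hs : 0 ≤ s) {x y : ℕ → Plane}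
    (u : ℕ → unitInterval) (g : ℕ → ℝ) (h1 : ∀ j, y j ∉ Metric.closedBall (0 : Plane) s)
    (h2 : ∀ j, ∃ k, x k ∈ Metric.closedBall (y j) (‖y j‖ / 2)) :
    dlInterference α θ R P x y u g ≤ dlInterferenceBound α P s x y g := by
  unfold dlInterference dlInterferenceBound
  rw [ENNReal.tsum_comm]
  refine ENNReal.tsum_le_tsum fun i => ?_
  split_ifs with hi
  swap
  · exact zero_le
  obtain ⟨_, j, ⟨hj, _⟩, _⟩ := hi
  refine le_trans ?_ (ENNReal.le_tsum j)
  rw [Set.indicator_of_mem (by exact hj), Set.indicator_of_mem (by exact h1 j),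
    ENNReal.ofReal_mul' (pathGain_nonneg _ _ (norm_nonneg _)), Pi.one_apply, one_mul,
    ← ENNReal.ofReal_mul (p := (2 : ℝ) ^ α) (by positivity)]
  gcongr
  obtain ⟨k, hk⟩ := h2 j
  have h3 : dist (y j) (x i) ≤ ‖y j‖ / 2 := (hj k).trans (by rwa [dist_comm])
  have h4 : 0 < ‖y j‖ := hs.trans_lt (by simpa using h1 j)
  have h5 : ‖y j‖ / 2 ≤ ‖x i‖ := by
    have := norm_le_norm_add_norm_sub' (y j) (x i)
    rw [← dist_eq_norm] at this
    linarith
  calc pathGain α R ‖x i‖ ≤ ‖x i‖ ^ (-α) := pathGain_le _ _ (norm_nonneg _)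
    _ ≤ (‖y j‖ / 2) ^ (-α) := Real.rpow_le_rpow_of_nonpos (by positivity) h5 (by linarith)
    _ = 2 ^ α * ‖y j‖ ^ (-α) := by
      rw [Real.div_rpow h4.le two_pos.le, Real.rpow_neg two_pos.le, div_inv_eq_mul, mul_comm]

theorem measurable_dlInterferenceBound (α P s : ℝ) :
    Measurable fun ω : Sample => dlInterferenceBound α P s ω.1 ω.2.1 ω.2.2.2.2 := by
  refine Measurable.tsum fun j => Measurable.tsum fun i => Measurable.mul ?_ (Measurable.mul
    (by fun_prop) ?_)
  · exact measurable_one.indicator (measurableSet_assoc (x := fun ω : Sample => ω.1)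
      (z := fun ω : Sample => ω.2.1 j) (by fun_prop) (by fun_prop) i)
  · exact (Measurable.indicator (by fun_prop) Metric.isClosed_closedBall.measurableSet.compl).comp
      (g := (Metric.closedBall (0 : Plane) s)ᶜ.indicator
      (fun z => ENNReal.ofReal (2 ^ α) * ENNReal.ofReal (‖z‖ ^ (-α))))
      (f := fun ω : Sample => ω.2.1 j) (by fun_prop)

theorem lintegral_dlInterferenceBound_le {α P s : ℝ} (hα : 2 < α) (hP : 0 < P) (hs : 0 < s)
    (hM : 0 < lamM) (hU : 0 < lamU) (hQB : IsPoissonProcess QB lamM)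
    (hQU : IsPoissonProcess QU lamU) :
    ∫⁻ ω, dlInterferenceBound α P s ω.1 ω.2.1 ω.2.2.2.2 ∂(networkLaw QB QU) ≤
      ENNReal.ofReal (2 * P * 2 ^ α * (2 * Real.pi / (α - 2)) * (lamU * s ^ (2 - α))) := by
  have := hQB.prob
  have := hQU.prob
  let c : Plane → ℝ≥0∞ := (Metric.closedBall (0 : Plane) s)ᶜ.indicator
      (fun z => ENNReal.ofReal (2 ^ α) * ENNReal.ofReal (‖z‖ ^ (-α)))
  have hc : Measurable c :=
    Measurable.indicator (by fun_prop) Metric.isClosed_closedBall.measurableSet.compl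
  let F : (ℕ → Plane) → Plane → ℝ≥0∞ := fun x z =>
    (∑' i, {x | Assoc x i z}.indicator 1 x) * (ENNReal.ofReal P * c z)
  have hA : ∀ i, Measurable fun p : (ℕ → Plane) × Plane =>
      {x | Assoc x i p.2}.indicator (1 : (ℕ → Plane) → ℝ≥0∞) p.1 := fun i =>
    measurable_one.indicator (measurableSet_assoc (x := fun p : (ℕ → Plane) × Plane => p.1)
      (z := fun p => p.2) (by fun_prop) (by fun_prop) i)
  have hF : Measurable (Function.uncurry F) :=
    (Measurable.tsum hA).mul (measurable_const.mul (hc.comp measurable_snd))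
  have h1 : ∀ x y : ℕ → Plane, ∫⁻ g, dlInterferenceBound α P s x y g ∂fadingLaw =
      ∑' j, F x (y j) := by
    intro x y
    have hm : ∀ i j, Measurable fun g : ℕ → ℝ =>
        {x | Assoc x i (y j)}.indicator 1 x * (ENNReal.ofReal (P * g i) * c (y j)) := by
      intro i j; fun_prop
    unfold dlInterferenceBound
    rw [lintegral_tsum fun j => (Measurable.tsum fun i => hm i j).aemeasurable]
    refine tsum_congr fun j => ?_
    simp only [F]
    rw [lintegral_tsum fun i => (hm i j).aemeasurable, ← ENNReal.tsum_mul_right]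
    refine tsum_congr fun i => ?_
    rw [lintegral_const_mul _ (by fun_prop), lintegral_mul_const _ (by fun_prop),
      lintegral_fadingLaw_eval P hP.le]
  rw [lintegral_networkLaw (measurable_dlInterferenceBound α P s)]
  simp_rw [h1, lintegral_const, measure_univ, mul_one]
  rw [lintegral_lintegral_tsum hQU hU.le hF]
  have h2 : ∀ z, ∫⁻ x, F x z ∂QB ≤ 2 * (ENNReal.ofReal P * c z) := by
    intro z
    simp only [F]
    have hm : Measurable fun x : ℕ → Plane =>
        ∑' i, {x | Assoc x i z}.indicator (1 : (ℕ → Plane) → ℝ≥0∞) x :=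
      Measurable.tsum fun i => measurable_one.indicator (measurableSet_assoc
        (x := fun x : ℕ → Plane => x) (z := fun _ => z) (by fun_prop) measurable_const i)
    rw [lintegral_mul_const _ hm]
    gcongr
    exact hQB.lintegral_tsum_assoc_le hM z
  refine (mul_le_mul_right (lintegral_mono h2) _).trans ?_
  rw [lintegral_const_mul _ (by fun_prop), lintegral_const_mul _ hc, lintegral_indicator
    Metric.isClosed_closedBall.measurableSet.compl, lintegral_const_mul _ (by fun_prop),
    setLIntegral_rpow_compl_closedBall hα hs, show (2 : ℝ≥0∞) = ENNReal.ofReal 2 by simp,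
    ← ENNReal.ofReal_mul (by positivity), ← ENNReal.ofReal_mul (by positivity),
    ← ENNReal.ofReal_mul (by positivity), ← ENNReal.ofReal_mul (by positivity)]
  exact ENNReal.ofReal_le_ofReal (le_of_eq (by ring))

/-- A tail bound for the downlink interference. The first summand bounds the probability that a user
is within distance `s` of the origin, the second one that some user `y` has no BS within `‖y‖ / 2`,
and the third one comes from Markov's inequality for `dlInterferenceBound`. -/
theorem networkLaw_lt_dlInterference_le {α θ R P s T : ℝ} (hα : 2 < α) (hP : 0 < P) (hs : 0 < s)
    (hT : 0 < T) (hM : 0 < lamM) (hU : 0 < lamU) (hQB : IsPoissonProcess QB lamM)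
    (hQU : IsPoissonProcess QU lamU) :
    networkLaw QB QU {ω | ENNReal.ofReal T < dlInterference α θ R P ω.1 ω.2.1 ω.2.2.1 ω.2.2.2.2} ≤
      ENNReal.ofReal (lamU * (s ^ 2 * Real.pi) + lamU * (1 / (lamM / 4)) +
        2 * P * 2 ^ α * (2 * Real.pi / (α - 2)) * (lamU * s ^ (2 - α)) / T) := by
  have := hQB.prob
  have := hQU.prob
  have hpi := Real.pi_pos
  have hα2 : 0 < α - 2 := by linarith
  let V : Set ((ℕ → Plane) × Plane) := {p | ∀ k, p.1 k ∉ Metric.closedBall p.2 (‖p.2‖ / 2)}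
  have hV : MeasurableSet V := by
    have : V = ⋂ k, {p | ‖p.2‖ / 2 < dist (p.1 k) p.2} := by ext p; simp [V]
    rw [this]
    refine MeasurableSet.iInter fun k => measurableSet_lt (by fun_prop) (by fun_prop)
  let E1 : Set Sample := {ω | ∃ j, ω.2.1 j ∈ Metric.closedBall (0 : Plane) s}
  let E2 : Set Sample := {ω | ∃ j, (ω.1, ω.2.1 j) ∈ V}
  let E3 : Set Sample :=
    {ω | ENNReal.ofReal T ≤ dlInterferenceBound α P s ω.1 ω.2.1 ω.2.2.2.2}
  have hsub : {ω : Sample | ENNReal.ofReal T <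
      dlInterference α θ R P ω.1 ω.2.1 ω.2.2.1 ω.2.2.2.2} ⊆ (E1 ∪ E2) ∪ E3 := by
    intro ω hω
    by_cases h1 : ω ∈ E1
    · exact Or.inl (Or.inl h1)
    by_cases h2 : ω ∈ E2
    · exact Or.inl (Or.inr h2)
    right
    refine le_trans (le_of_lt hω) (dlInterference_le (by linarith) hs.le _ _
      (fun j hj => h1 ⟨j, hj⟩) fun j => ?_)
    by_contra hj
    push Not at hj
    exact h2 ⟨j, hj⟩
  have hE1 : networkLaw QB QU E1 ≤ ENNReal.ofReal (lamU * (s ^ 2 * Real.pi)) := by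
    have hm : MeasurableSet {y : ℕ → Plane | ∃ j, y j ∈ Metric.closedBall (0 : Plane) s} :=
      IsPoissonProcess.measurableSet_exists_mem Metric.isClosed_closedBall.measurableSet
    refine ((measurePreserving_users QB QU).measure_preimage hm.nullMeasurableSet).le.trans ?_
    refine (hQU.exists_mem_le hU.le Metric.isClosed_closedBall.measurableSet).trans ?_
    rw [EuclideanSpace.volume_closedBall_fin_two, ENNReal.ofReal_mul hU.le,
      ENNReal.ofReal_mul (by positivity), ENNReal.ofReal_pow hs.le]
  have hE2 : networkLaw QB QU E2 ≤ ENNReal.ofReal (lamU * (1 / (lamM / 4))) := by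
    let F : (ℕ → Plane) → Plane → ℝ≥0∞ := fun x z => V.indicator 1 (x, z)
    have hF : Measurable (Function.uncurry F) := measurable_one.indicator hV
    have hm : MeasurableSet E2 := by
      simp only [E2]
      rw [Set.ofPred_exists]
      exact MeasurableSet.iUnion fun j => hV.preimage
        (f := fun ω : Sample => (ω.1, ω.2.1 j)) (by fun_prop)
    have hle : ∀ ω : Sample, E2.indicator (1 : Sample → ℝ≥0∞) ω ≤ ∑' j, F ω.1 (ω.2.1 j) := by
      intro ω
      by_cases hω : ω ∈ E2
      · obtain ⟨j, hj⟩ := hω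
        refine le_trans ?_ (ENNReal.le_tsum j)
        simp only [F]
        rw [Set.indicator_of_mem hj, Set.indicator_of_mem (by exact ⟨j, hj⟩)]
        exact le_rfl
      · rw [Set.indicator_of_notMem hω]; exact zero_le
    rw [← lintegral_indicator_one hm]
    refine (lintegral_mono hle).trans ?_
    have hm' : Measurable fun ω : Sample => ∑' j, F ω.1 (ω.2.1 j) :=
      Measurable.tsum fun j => hF.comp (f := fun ω : Sample => (ω.1, ω.2.1 j)) (by fun_prop)
    rw [lintegral_networkLaw hm']
    simp_rw [lintegral_const, measure_univ, mul_one]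
    rw [lintegral_lintegral_tsum hQU hU.le hF]
    have h3 : ∀ z, ∫⁻ x, F x z ∂QB =
        ENNReal.ofReal (Real.exp (-(lamM / 4 * Real.pi * ‖z‖ ^ 2))) := by
      intro z
      have h4 : ∀ x, F x z = {x : ℕ → Plane |
          ∀ k, x k ∉ Metric.closedBall z (‖z‖ / 2)}.indicator 1 x := fun x => rfl
      simp_rw [h4]
      rw [lintegral_indicator_one (IsPoissonProcess.measurableSet_void
        Metric.isClosed_closedBall.measurableSet), hQB.void_closedBall hM.le z (by positivity)]
      congr 2; ring
    simp_rw [h3]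
    rw [lintegral_exp_neg_sq (by positivity), ENNReal.ofReal_mul hU.le]
  have hE3 : networkLaw QB QU E3 ≤
      ENNReal.ofReal (2 * P * 2 ^ α * (2 * Real.pi / (α - 2)) * (lamU * s ^ (2 - α)) / T) := by
    rw [ENNReal.ofReal_div_of_pos hT]
    refine (meas_ge_le_lintegral_div (measurable_dlInterferenceBound α P s).aemeasurable
      (by simp [hT]) ENNReal.ofReal_ne_top).trans ?_
    exact ENNReal.div_le_div_right
      (lintegral_dlInterferenceBound_le hα hP hs hM hU hQB hQU) _
  refine (measure_mono hsub).trans ((measure_union_le _ _).trans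
    ((add_le_add (measure_union_le _ _) le_rfl).trans
      ((add_le_add (add_le_add hE1 hE2) hE3).trans ?_)))
  rw [← ENNReal.ofReal_add (by positivity) (by positivity),
    ← ENNReal.ofReal_add (by positivity) (by positivity)]

/-! ### Downlink: lower bound -/

/-- The capacity that a link shorter than `ρ` has when its fading power is at least `δ` and the
interference is at most `T`. -/
def guaranteedCapacity (α P N δ ρ T : ℝ) : ℝ := Real.log (1 + P * δ * ρ ^ (-α) / (T + N))

theorem guaranteedCapacity_nonneg {α P N δ ρ T : ℝ} (hP : 0 ≤ P) (hN : 0 ≤ N) (hδ : 0 ≤ δ)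
    (hρ : 0 ≤ ρ) (hT : 0 ≤ T) : 0 ≤ guaranteedCapacity α P N δ ρ T :=
  Real.log_nonneg (le_add_of_nonneg_right (by positivity))

theorem guaranteedCapacity_le_dlCapacity {α θ R P N δ ρ T : ℝ} (hα : 0 < α) (hP : 0 < P)
    (hN : 0 < N) (hδ : 0 ≤ δ) (hρ : 0 < ρ) (hρR : ρ ≤ R) (hT : 0 ≤ T) {ω : Sample}
    (h1 : 0 < ⨅ i, ‖ω.1 i‖) (h2 : (⨅ i, ‖ω.1 i‖) ≤ ρ) (h3 : δ ≤ ω.2.2.2.1)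
    (h4 : dlInterference α θ R P ω.1 ω.2.1 ω.2.2.1 ω.2.2.2.2 ≤ ENNReal.ofReal T) :
    guaranteedCapacity α P N δ ρ T ≤ dlCapacity α θ R P N ω := by
  refine Real.log_le_log (by positivity) ?_
  gcongr
  refine le_toReal_div_add hN hT ENNReal.ofReal_ne_top (ENNReal.ofReal_le_ofReal ?_) h4
  rw [pathGain, if_pos (h2.trans hρR)]
  have : ρ ^ (-α) ≤ (⨅ i, ‖ω.1 i‖) ^ (-α) := Real.rpow_le_rpow_of_nonpos h1 h2 (by linarith)
  have : 0 < ρ ^ (-α) := by positivity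
  have : P * δ ≤ P * ω.2.2.2.1 := by gcongr
  have : 0 ≤ P * δ := by positivity
  gcongr
  linarith

/-- The capacity is as guaranteed whenever some BS lies within `ρ`, except for an event of small
probability. -/
theorem networkLaw_guaranteedCapacity_le {α θ R P N s δ ρ T : ℝ} (hα : 2 < α) (hP : 0 < P)
    (hN : 0 < N) (hs : 0 < s) (hδ : 0 ≤ δ) (hρ : 0 < ρ) (hρR : ρ ≤ R)
    (hT : 0 < T) (hM : 0 < lamM) (hU : 0 < lamU) (hQB : IsPoissonProcess QB lamM)
    (hQU : IsPoissonProcess QU lamU) :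
    ENNReal.ofReal (1 - Real.exp (-(lamM * Real.pi * ρ ^ 2))) ≤
      networkLaw QB QU {ω | guaranteedCapacity α P N δ ρ T ≤ dlCapacity α θ R P N ω} +
        (ENNReal.ofReal δ + ENNReal.ofReal (lamU * (s ^ 2 * Real.pi) + lamU * (1 / (lamM / 4)) +
        2 * P * 2 ^ α * (2 * Real.pi / (α - 2)) * (lamU * s ^ (2 - α)) / T)) := by
  have := hQB.prob
  have := hQU.prob
  have hA : MeasurableSet {x : ℕ → Plane | ∃ i, x i ∈ Metric.closedBall (0 : Plane) ρ} :=
    IsPoissonProcess.measurableSet_exists_mem Metric.isClosed_closedBall.measurableSet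
  have h0 : networkLaw QB QU {ω | ∃ i, ω.1 i ∈ Metric.closedBall (0 : Plane) ρ} =
      ENNReal.ofReal (1 - Real.exp (-(lamM * Real.pi * ρ ^ 2))) := by
    rw [← hQB.exists_mem_closedBall hM.le 0 hρ.le]
    exact (measurePreserving_bs QB QU).measure_preimage hA.nullMeasurableSet
  have h1 : networkLaw QB QU {ω | ω.2.2.2.1 ≤ δ} ≤ ENNReal.ofReal δ :=
    ((measurePreserving_fading QB QU).measure_preimage
      (measurableSet_Iic (a := δ)).nullMeasurableSet).le.trans (expMeasure_one_Iic_le hδ)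
  have h2 := networkLaw_lt_dlInterference_le (θ := θ) (R := R) hα hP hs hT hM hU hQB hQU
  have hae : ∀ᵐ ω ∂(networkLaw QB QU), ∃ i, ω.1 i ≠ 0 ∧ (⨅ k, ‖ω.1 k‖) = ‖ω.1 i‖ :=
    (measurePreserving_bs QB QU).quasiMeasurePreserving.ae (hQB.ae_exists_norm_eq_iInf hM.le)
  rw [← h0]
  refine le_trans ?_ (add_le_add_right (add_le_add h1 h2) _)
  refine le_trans (measure_mono_ae ?_) ((measure_union_le _ _).trans
    (add_le_add_right (measure_union_le _ _) _))
  filter_upwards [hae] with ω ⟨i, hi0, hi⟩ ⟨k, hk⟩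
  by_contra hcon
  change ¬ (_ ∨ _ ∨ _) at hcon
  rw [not_or, not_or] at hcon
  obtain ⟨c1, c2, c3⟩ := hcon
  refine c1 (guaranteedCapacity_le_dlCapacity (by linarith) hP hN hδ hρ hρR hT.le ?_ ?_
    (le_of_lt (not_le.1 c2)) (not_lt.1 c3))
  · rw [hi]; exact norm_pos_iff.2 hi0
  · refine (ciInf_le ⟨0, ?_⟩ k).trans (by simpa using hk)
    rintro _ ⟨k, rfl⟩; positivity

end Network

/-! ### The Voronoi cell of a typical BS -/

/-- The Voronoi cell of the BS at the origin. -/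
def originCell (x : ℕ → Plane) : Set Plane := {z | Assoc (withOrigin x) none z}

theorem mem_originCell_iff {x : ℕ → Plane} {z : Plane} :
    z ∈ originCell x ↔ ∀ k, x k ∉ Metric.ball z ‖z‖ := by
  change (∀ k, dist z (withOrigin x none) ≤ dist z (withOrigin x k)) ↔ _
  simp [Option.forall, withOrigin, dist_comm]

theorem measurableSet_mem_originCell :
    MeasurableSet {p : (ℕ → Plane) × Plane | p.2 ∈ originCell p.1} :=
  measurableSet_assoc (measurable_withOrigin measurable_fst) measurable_snd none

theorem measurableSet_originCell (x : ℕ → Plane) : MeasurableSet (originCell x) :=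
  measurableSet_mem_originCell.preimage (f := fun z => (x, z)) (by fun_prop)

theorem measurable_indicator_originCell {f : Plane → ℝ≥0∞} (hf : Measurable f) :
    Measurable (Function.uncurry fun (x : ℕ → Plane) z => (originCell x).indicator f z) :=
  (hf.comp measurable_snd).indicator measurableSet_mem_originCell

theorem exp_neg_le_quadratic {t : ℝ} (ht : 0 ≤ t) : Real.exp (-t) ≤ 1 - t + t ^ 2 / 2 := by
  have h1 := Real.quadratic_le_exp_of_nonneg ht
  have h2 : 0 < 1 + t + t ^ 2 / 2 := by positivity
  rw [Real.exp_neg]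
  refine (inv_anti₀ h2 h1).trans ?_
  rw [inv_le_iff_one_le_mul₀ h2]
  nlinarith [sq_nonneg (t ^ 2)]

section Cell

variable {QB QU : Measure (ℕ → Plane)} {lamM lamU : ℝ}

theorem measure_mem_originCell (hQB : IsPoissonProcess QB lamM) (hM : 0 ≤ lamM) (z : Plane) :
    QB {x | z ∈ originCell x} = ENNReal.ofReal (Real.exp (-(lamM * Real.pi * ‖z‖ ^ 2))) := by
  simp_rw [mem_originCell_iff]
  exact hQB.void_ball hM z (norm_nonneg z)

theorem lintegral_indicator_originCell (hQB : IsPoissonProcess QB lamM) (hM : 0 ≤ lamM)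
    (f : Plane → ℝ≥0∞) (z : Plane) :
    ∫⁻ x, (originCell x).indicator f z ∂QB =
      ENNReal.ofReal (Real.exp (-(lamM * Real.pi * ‖z‖ ^ 2))) * f z := by
  have hm : MeasurableSet {x : ℕ → Plane | z ∈ originCell x} :=
    measurableSet_mem_originCell.preimage (f := fun x => (x, z)) (by fun_prop)
  rw [← measure_mem_originCell hQB hM z, mul_comm, ← lintegral_indicator_const hm]
  rfl

theorem measurable_volume_originCell :
    Measurable fun x : ℕ → Plane => volume (originCell x) :=
  measurable_measure_prodMk_left measurableSet_mem_originCell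

theorem lintegral_volume_originCell (hQB : IsPoissonProcess QB lamM) (hM : 0 < lamM) :
    ∫⁻ x, volume (originCell x) ∂QB = ENNReal.ofReal (1 / lamM) := by
  have := hQB.prob
  rw [← lintegral_exp_neg_sq hM]
  simp_rw [← fun x => lintegral_indicator_one (μ := volume) (measurableSet_originCell x)]
  rw [lintegral_lintegral_swap (measurable_indicator_originCell measurable_one).aemeasurable]
  refine lintegral_congr fun z => ?_
  rw [lintegral_indicator_originCell hQB hM.le, Pi.one_apply, mul_one]

theorem ae_volume_originCell_ne_top (hQB : IsPoissonProcess QB lamM) (hM : 0 < lamM) :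
    ∀ᵐ x ∂QB, volume (originCell x) ≠ ⊤ := by
  have h := lintegral_volume_originCell hQB hM
  filter_upwards [ae_lt_top measurable_volume_originCell (by rw [h]; exact ENNReal.ofReal_ne_top)]
    with x hx using hx.ne

/-- Two locations `z`, `w` lie in the cell of the origin with probability at most
`exp (-lamM π max (‖z‖, ‖w‖)²)`, hence at most `exp (-lamM π (‖z‖² + ‖w‖²) / 2)`, a product. -/
theorem lintegral_volume_originCell_sq_le (hQB : IsPoissonProcess QB lamM) (hM : 0 < lamM) :
    ∫⁻ x, volume (originCell x) ^ 2 ∂QB ≤ ENNReal.ofReal (4 / lamM ^ 2) := by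
  have := hQB.prob
  have hpi := Real.pi_pos
  let c : (ℕ → Plane) → Plane → ℝ≥0∞ := fun x z => (originCell x).indicator 1 z
  have hc : Measurable (Function.uncurry c) := measurable_indicator_originCell measurable_one
  have hcz : ∀ x, Measurable (c x) := fun x => measurable_one.indicator (measurableSet_originCell x)
  have h1 : ∀ x, volume (originCell x) ^ 2 = ∫⁻ p : Plane × Plane, c x p.1 * c x p.2 := by
    intro x
    rw [Measure.volume_eq_prod, lintegral_prod_mul (hcz x).aemeasurable (hcz x).aemeasurable,
      lintegral_indicator_one (measurableSet_originCell x), sq]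
  let e : Plane → ℝ≥0∞ := fun z => ENNReal.ofReal (Real.exp (-(lamM / 2 * Real.pi * ‖z‖ ^ 2)))
  have h2 : ∀ p : Plane × Plane, ∫⁻ x, c x p.1 * c x p.2 ∂QB ≤ e p.1 * e p.2 := by
    rintro ⟨z, w⟩
    have hb : ∀ a : Plane, ∫⁻ x, c x a ∂QB =
        ENNReal.ofReal (Real.exp (-(lamM * Real.pi * ‖a‖ ^ 2))) := fun a => by
      simp only [c]
      rw [lintegral_indicator_originCell hQB hM.le, Pi.one_apply, mul_one]
    have hle : ∀ x a, c x a ≤ 1 := fun x a => Set.indicator_le_self' (by simp) a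
    have h3 : ∫⁻ x, c x z * c x w ∂QB ≤
        ENNReal.ofReal (Real.exp (-(lamM * Real.pi * ‖z‖ ^ 2))) := by
      rw [← hb]
      exact lintegral_mono fun x => mul_le_of_le_one_right' (hle x w)
    have h4 : ∫⁻ x, c x z * c x w ∂QB ≤
        ENNReal.ofReal (Real.exp (-(lamM * Real.pi * ‖w‖ ^ 2))) := by
      rw [← hb]
      exact lintegral_mono fun x => mul_le_of_le_one_left' (hle x z)
    simp only [e]
    rw [← ENNReal.ofReal_mul (Real.exp_pos _).le, ← Real.exp_add]
    have hp : 0 ≤ lamM * Real.pi := by positivity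
    rcases le_total (‖z‖ ^ 2) (‖w‖ ^ 2) with hzw | hzw
    · refine h4.trans (ENNReal.ofReal_le_ofReal (Real.exp_le_exp.2 ?_))
      nlinarith [mul_le_mul_of_nonneg_left hzw hp]
    · refine h3.trans (ENNReal.ofReal_le_ofReal (Real.exp_le_exp.2 ?_))
      nlinarith [mul_le_mul_of_nonneg_left hzw hp]
  have hm : Measurable (Function.uncurry fun (x : ℕ → Plane) (p : Plane × Plane) =>
      c x p.1 * c x p.2) :=
    (hc.comp (f := fun q : (ℕ → Plane) × (Plane × Plane) => (q.1, q.2.1)) (by fun_prop)).mul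
      (hc.comp (f := fun q : (ℕ → Plane) × (Plane × Plane) => (q.1, q.2.2)) (by fun_prop))
  have he : Measurable e := by fun_prop
  simp_rw [h1]
  rw [lintegral_lintegral_swap hm.aemeasurable]
  refine (lintegral_mono h2).trans ?_
  rw [Measure.volume_eq_prod, lintegral_prod_mul he.aemeasurable he.aemeasurable,
    lintegral_exp_neg_sq (by positivity), ← ENNReal.ofReal_mul (by positivity)]
  exact ENNReal.ofReal_le_ofReal (le_of_eq (by field_simp; norm_num))

/-- The mean of a sum over the users in the cell of the origin, with a weight depending on the
fading power of the desired link. -/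
theorem lintegral_tsum_originCell (hQB : IsPoissonProcess QB lamM) (hQU : IsPoissonProcess QU lamU)
    (hM : 0 ≤ lamM) (hU : 0 ≤ lamU) {f : Plane → ℝ≥0∞} (hf : Measurable f) {w : ℝ → ℝ≥0∞}
    (hw : Measurable w) :
    ∫⁻ s, w s.2.2.2.1 * ∑' j, (originCell s.1).indicator f (s.2.1 j) ∂(networkLaw QB QU) =
      (∫⁻ h, w h ∂(expMeasure 1)) * (ENNReal.ofReal lamU *
        ∫⁻ z, ENNReal.ofReal (Real.exp (-(lamM * Real.pi * ‖z‖ ^ 2))) * f z) := by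
  have := hQB.prob
  have := hQU.prob
  have hF := measurable_indicator_originCell hf
  have hS : Measurable fun p : (ℕ → Plane) × (ℕ → Plane) =>
      ∑' j, (originCell p.1).indicator f (p.2 j) := Measurable.tsum fun j =>
    hF.comp (f := fun p : (ℕ → Plane) × (ℕ → Plane) => (p.1, p.2 j)) (by fun_prop)
  have hm : Measurable fun s : Sample =>
      w s.2.2.2.1 * ∑' j, (originCell s.1).indicator f (s.2.1 j) :=
    (hw.comp (by fun_prop)).mul (hS.comp (f := fun s : Sample => (s.1, s.2.1)) (by fun_prop))
  rw [lintegral_networkLaw hm]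
  dsimp only
  simp only [lintegral_const, measure_univ, mul_one, lintegral_mul_const _ hw]
  have h1 : ∀ x, ∫⁻ y, (∫⁻ h, w h ∂(expMeasure 1)) *
      ∑' j, (originCell x).indicator f (y j) ∂QU = (∫⁻ h, w h ∂(expMeasure 1)) *
      ∫⁻ y, ∑' j, (originCell x).indicator f (y j) ∂QU := fun x =>
    lintegral_const_mul _ (hS.comp (f := fun y => (x, y)) (by fun_prop))
  simp_rw [h1]
  rw [lintegral_const_mul _ (hS.lintegral_prod_right'), lintegral_lintegral_tsum hQU hU hF]
  simp_rw [lintegral_indicator_originCell hQB hM]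

theorem lintegral_tsum_originCell_one (hQB : IsPoissonProcess QB lamM)
    (hQU : IsPoissonProcess QU lamU) (hM : 0 < lamM) (hU : 0 ≤ lamU) :
    ∫⁻ s, ∑' j, (originCell s.1).indicator 1 (s.2.1 j) ∂(networkLaw QB QU) =
      ENNReal.ofReal (lamU / lamM) := by
  have h := lintegral_tsum_originCell hQB hQU hM.le hU (f := 1) measurable_one
    (w := 1) measurable_one
  simp only [Pi.one_apply, one_mul, mul_one] at h
  rw [h, lintegral_exp_neg_sq hM, lintegral_one, measure_univ, one_mul,
    ← ENNReal.ofReal_mul hU, mul_one_div]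

theorem measurable_tsum_originCell {f : Plane → ℝ≥0∞} (hf : Measurable f) :
    Measurable fun s : Sample => ∑' j, (originCell s.1).indicator f (s.2.1 j) :=
  Measurable.tsum fun j => (measurable_indicator_originCell hf).comp
    (f := fun s : Sample => (s.1, s.2.1 j)) (by fun_prop)

theorem ae_finite_originCell (hQB : IsPoissonProcess QB lamM) (hQU : IsPoissonProcess QU lamU)
    (hM : 0 < lamM) (hU : 0 ≤ lamU) :
    ∀ᵐ s ∂(networkLaw QB QU), {j | s.2.1 j ∈ originCell s.1}.Finite := by
  have h := lintegral_tsum_originCell_one hQB hQU hM hU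
  filter_upwards [ae_lt_top (measurable_tsum_originCell measurable_one)
    (by rw [h]; exact ENNReal.ofReal_ne_top)] with s hs
  rw [← toENNReal_encard] at hs
  exact Set.encard_lt_top_iff.1 (by simpa using hs)

/-- Almost surely, no user in the cell of the origin is as near to another BS: the probability that
the disc around `z` through the origin contains no BS is the same for the open and the closed
disc. -/
theorem ae_norm_lt_dist (hQB : IsPoissonProcess QB lamM) (hQU : IsPoissonProcess QU lamU)
    (hM : 0 < lamM) (hU : 0 ≤ lamU) :
    ∀ᵐ s ∂(networkLaw QB QU), ∀ j, s.2.1 j ∈ originCell s.1 → ∀ i,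
      ‖s.2.1 j‖ < dist (s.2.1 j) (s.1 i) := by
  have := hQB.prob
  have := hQU.prob
  let V : Set ((ℕ → Plane) × Plane) := {p | ∀ k, p.1 k ∉ Metric.closedBall p.2 ‖p.2‖}
  have hV : MeasurableSet V := by
    have : V = ⋂ k, {p | ‖p.2‖ < dist (p.1 k) p.2} := by ext p; simp [V]
    rw [this]
    exact MeasurableSet.iInter fun k => measurableSet_lt (by fun_prop) (by fun_prop)
  let W : Set ((ℕ → Plane) × Plane) := {p | p.2 ∈ originCell p.1} \ V
  have hW : MeasurableSet W := measurableSet_mem_originCell.diff hV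
  let F : (ℕ → Plane) → Plane → ℝ≥0∞ := fun x z => W.indicator 1 (x, z)
  have hF : Measurable (Function.uncurry F) := measurable_one.indicator hW
  have h0 : ∀ z, ∫⁻ x, F x z ∂QB = 0 := by
    intro z
    have hVz : MeasurableSet {x | (x, z) ∈ V} := hV.preimage (f := fun x => (x, z)) (by fun_prop)
    have h1 : ∀ x, F x z = ({x | z ∈ originCell x} \ {x | (x, z) ∈ V}).indicator 1 x :=
      fun x => rfl
    simp_rw [h1]
    have hCz : MeasurableSet {x | z ∈ originCell x} :=
      measurableSet_mem_originCell.preimage (f := fun x => (x, z)) (by fun_prop)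
    rw [lintegral_indicator_one (hCz.diff hVz), measure_sdiff _ hVz.nullMeasurableSet
      (measure_ne_top _ _), measure_mem_originCell hQB hM.le,
      show {x | (x, z) ∈ V} = {x : ℕ → Plane | ∀ k, x k ∉ Metric.closedBall z ‖z‖} from rfl,
      hQB.void_closedBall hM.le z (norm_nonneg z), tsub_self]
    intro x hx
    exact mem_originCell_iff.2 fun k hk => hx k (Metric.ball_subset_closedBall hk)
  have hm : Measurable fun s : Sample => ∑' j, F s.1 (s.2.1 j) :=
    Measurable.tsum fun j => hF.comp (f := fun ω : Sample => (ω.1, ω.2.1 j)) (by fun_prop)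
  have h2 : ∫⁻ s, ∑' j, F s.1 (s.2.1 j) ∂(networkLaw QB QU) = 0 := by
    rw [lintegral_networkLaw hm]
    simp_rw [lintegral_const, measure_univ, mul_one]
    rw [lintegral_lintegral_tsum hQU hU hF]
    simp [h0]
  rw [lintegral_eq_zero_iff hm] at h2
  filter_upwards [h2] with s hs j hj i
  have h3 : F s.1 (s.2.1 j) = 0 := ENNReal.tsum_eq_zero.1 hs j
  by_contra hcon
  have hmem : (s.1, s.2.1 j) ∈ W := ⟨hj, fun hv => hv i (by
    rw [Metric.mem_closedBall, dist_comm]; exact not_lt.1 hcon)⟩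
  simp only [F] at h3
  rw [Set.indicator_of_mem hmem] at h3
  exact one_ne_zero h3

/-! ### The activity of a typical BS -/

/-- There is a user in the cell of the origin. -/
def OriginCellHasUser (x y : ℕ → Plane) : Prop := ∃ j, y j ∈ originCell x

theorem measurableSet_originCellHasUser :
    MeasurableSet {p : (ℕ → Plane) × (ℕ → Plane) | OriginCellHasUser p.1 p.2} := by
  simp only [OriginCellHasUser]
  rw [Set.ofPred_exists]
  exact MeasurableSet.iUnion fun j => measurableSet_mem_originCell.preimage
    (f := fun p : (ℕ → Plane) × (ℕ → Plane) => (p.1, p.2 j)) (by fun_prop)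

theorem OriginActive.hasUser {x y : ℕ → Plane} {u : ℕ → unitInterval} (h : OriginActive x y u) :
    OriginCellHasUser x y := by
  obtain ⟨j, hj, _⟩ := h
  exact ⟨j, hj⟩

/-- Among finitely many users one has the least mark. -/
theorem originActive_of_hasUser {x y : ℕ → Plane} {u : ℕ → unitInterval}
    (hfin : {j | y j ∈ originCell x}.Finite) (h : OriginCellHasUser x y) : OriginActive x y u := by
  obtain ⟨j, hj, hmin⟩ := Set.exists_min_image _ u hfin h
  exact ⟨j, hj, fun k hk => hmin k hk⟩

theorem networkLaw_hasUser_le (hQB : IsPoissonProcess QB lamM) (hQU : IsPoissonProcess QU lamU)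
    (hM : 0 < lamM) (hU : 0 ≤ lamU) :
    networkLaw QB QU {s | OriginCellHasUser s.1 s.2.1} ≤ ENNReal.ofReal (lamU / lamM) := by
  have hm : MeasurableSet {s : Sample | OriginCellHasUser s.1 s.2.1} :=
    measurableSet_originCellHasUser.preimage (f := fun s : Sample => (s.1, s.2.1)) (by fun_prop)
  rw [← lintegral_tsum_originCell_one hQB hQU hM hU, ← lintegral_indicator_one hm]
  refine lintegral_mono fun s => ?_
  by_cases hs : OriginCellHasUser s.1 s.2.1
  · obtain ⟨j, hj⟩ := hs
    refine le_trans ?_ (ENNReal.le_tsum j)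
    rw [Set.indicator_of_mem hj, Set.indicator_of_mem (by exact ⟨j, hj⟩)]
    exact le_rfl
  · rw [Set.indicator_of_notMem (by exact hs)]; exact zero_le

theorem networkLaw_hasUser_eq [IsProbabilityMeasure QB] [IsProbabilityMeasure QU] :
    networkLaw QB QU {s | OriginCellHasUser s.1 s.2.1} =
      ∫⁻ x, QU {y | ∃ j, y j ∈ originCell x} ∂QB := by
  refine ((measurePreserving_bs_users QB QU).measure_preimage
    measurableSet_originCellHasUser.nullMeasurableSet).trans ?_
  rw [Measure.prod_apply measurableSet_originCellHasUser]
  rfl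

/-- The cell of the origin rarely contains two or more users, so that it contains one with almost
the probability `lamU / lamM`, its mean number of users. With `v` the area of the cell, this is the
mean of `1 - exp (-lamU v) ≥ lamU v - (lamU v)² / 2`. -/
theorem le_networkLaw_hasUser_add (hQB : IsPoissonProcess QB lamM)
    (hQU : IsPoissonProcess QU lamU) (hM : 0 < lamM) (hU : 0 ≤ lamU) :
    ENNReal.ofReal (lamU / lamM) ≤ networkLaw QB QU {s | OriginCellHasUser s.1 s.2.1} +
      ENNReal.ofReal (2 * (lamU / lamM) ^ 2) := by
  have := hQB.prob
  have := hQU.prob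
  have h1 : ∀ᵐ x ∂QB, ENNReal.ofReal lamU * volume (originCell x) ≤
      ENNReal.ofReal (lamU ^ 2 / 2) * volume (originCell x) ^ 2 +
        QU {y | ∃ j, y j ∈ originCell x} := by
    filter_upwards [ae_volume_originCell_ne_top hQB hM] with x hx
    have hC := measurableSet_originCell x
    have hE : {y : ℕ → Plane | ∃ j, y j ∈ originCell x} = {y | ∀ j, y j ∉ originCell x}ᶜ := by
      ext y; simp
    rw [hE, measure_compl (IsPoissonProcess.measurableSet_void hC) (measure_ne_top _ _),
      hQU.void hU hC hx, measure_univ, ← ENNReal.ofReal_one,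
      ← ENNReal.ofReal_sub _ (Real.exp_pos _).le]
    set v := (volume (originCell x)).toReal with hv
    have hv0 : 0 ≤ v := ENNReal.toReal_nonneg
    have hexp : Real.exp (-(lamU * v)) ≤ 1 := Real.exp_le_one_iff.2 (by
      simp only [Left.neg_nonpos_iff]; positivity)
    rw [← ENNReal.ofReal_toReal hx, ← hv, ← ENNReal.ofReal_pow hv0, ← ENNReal.ofReal_mul hU,
      ← ENNReal.ofReal_mul (by positivity), ← ENNReal.ofReal_add (by positivity) (by linarith)]
    refine ENNReal.ofReal_le_ofReal ?_
    have := exp_neg_le_quadratic (show 0 ≤ lamU * v by positivity)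
    nlinarith
  have h2 := lintegral_mono_ae h1
  rw [lintegral_const_mul _ measurable_volume_originCell,
    lintegral_add_left ((measurable_volume_originCell.pow_const 2).const_mul _),
    lintegral_const_mul _ (measurable_volume_originCell.pow_const 2),
    lintegral_volume_originCell hQB hM, ← networkLaw_hasUser_eq, ← ENNReal.ofReal_mul hU,
    mul_one_div, add_comm] at h2
  refine h2.trans (add_le_add_right ?_ _)
  refine (mul_le_mul_right (lintegral_volume_originCell_sq_le hQB hM) _).trans ?_
  rw [← ENNReal.ofReal_mul (by positivity)]
  exact ENNReal.ofReal_le_ofReal (le_of_eq (by field_simp; norm_num))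

theorem originActive_ae_eq (hQB : IsPoissonProcess QB lamM) (hQU : IsPoissonProcess QU lamU)
    (hM : 0 < lamM) (hU : 0 ≤ lamU) :
    networkLaw QB QU {s | OriginActive s.1 s.2.1 s.2.2.1} =
      networkLaw QB QU {s | OriginCellHasUser s.1 s.2.1} := by
  refine measure_congr ?_
  filter_upwards [ae_finite_originCell hQB hQU hM hU] with s hs
  exact propext ⟨fun h => OriginActive.hasUser h, fun h => originActive_of_hasUser hs h⟩

end Cell

/-! ### Uplink: upper bound -/

theorem log_one_add_sum_le {κ : Type*} (F : Finset κ) {b : κ → ℝ} (hb : ∀ j, 0 ≤ b j) :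
    Real.log (1 + ∑ j ∈ F, b j) ≤ ∑ j ∈ F, Real.log (1 + b j) := by
  classical
  induction F using Finset.induction_on with
  | empty => simp
  | insert j F hj ih =>
    rw [Finset.sum_insert hj, Finset.sum_insert hj]
    have h1 : 0 ≤ ∑ j ∈ F, b j := Finset.sum_nonneg fun j _ => hb j
    have h2 := hb j
    calc Real.log (1 + (b j + ∑ j ∈ F, b j)) ≤ Real.log ((1 + b j) * (1 + ∑ j ∈ F, b j)) :=
          Real.log_le_log (by positivity) (by nlinarith [mul_nonneg h2 h1])
      _ = Real.log (1 + b j) + Real.log (1 + ∑ j ∈ F, b j) :=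
          Real.log_mul (by positivity) (by positivity)
      _ ≤ _ := by gcongr

/-- Almost surely one user is selected, but this is not needed: finitely many users suffice for the
signal to be a finite sum over the selected users. -/
theorem ulSignal_eq_sum {α R P : ℝ} {x y : ℕ → Plane} (u : ℕ → unitInterval) (h : ℝ)
    (hfin : {j | y j ∈ originCell x}.Finite) : ∃ F : Finset ℕ,
      (∀ j, j ∈ F ↔ Scheduled (withOrigin x) y u none j) ∧
      ulSignal α R P x y u h = ∑ j ∈ F, ENNReal.ofReal (P * h * pathGain α R ‖y j‖) := by
  have hs : {j | Scheduled (withOrigin x) y u none j}.Finite := hfin.subset fun j hj => hj.1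
  refine ⟨hs.toFinset, by simp, ?_⟩
  unfold ulSignal
  rw [tsum_eq_sum (s := hs.toFinset)]
  · refine Finset.sum_congr rfl fun j hj => if_pos (by simpa using hj)
  · intro j hj
    exact if_neg (by simpa using hj)

/-- Subadditivity of `log (1 + ·)` bounds the capacity by a sum over all users in the cell, which
Campbell's formula can average. -/
theorem ofReal_ulCapacity_le {α θ R P N lam : ℝ} (hα : 0 < α) (hP : 0 < P) (hN : 0 < N)
    (hlam : 0 < lam) {s : Sample} (hfin : {j | s.2.1 j ∈ originCell s.1}.Finite) :
    ENNReal.ofReal (ulCapacity α θ R P N s) ≤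
      ENNReal.ofReal (P / N * max s.2.2.2.1 0) * ∑' j, (originCell s.1).indicator 1 (s.2.1 j) +
      1 * ∑' j, (originCell s.1).indicator
        (fun z => ENNReal.ofReal (logGainBound α R lam ‖z‖)) (s.2.1 j) := by
  obtain ⟨x, y, u, h, g⟩ := s
  dsimp only at hfin ⊢
  obtain ⟨F, hF, hS⟩ := ulSignal_eq_sum (α := α) (R := R) (P := P) u h hfin
  have hp : ∀ j, 0 ≤ pathGain α R ‖y j‖ := fun j => pathGain_nonneg α R (norm_nonneg _)
  have hb : ∀ j, 0 ≤ P / N * max h 0 * pathGain α R ‖y j‖ := fun j => by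
    have := hp j; positivity
  have hg : ∀ j, 0 ≤ logGainBound α R lam ‖y j‖ := fun j =>
    logGainBound_nonneg hα.le (norm_nonneg _)
  have h0 : 0 ≤ ∑ j ∈ F, P * max h 0 * pathGain α R ‖y j‖ := Finset.sum_nonneg fun j _ => by
    have := hp j; positivity
  have h1 : ulSINR α θ R P N x y u h g ≤ ∑ j ∈ F, P / N * max h 0 * pathGain α R ‖y j‖ := by
    have hle : ulSignal α R P x y u h ≤
        ENNReal.ofReal (∑ j ∈ F, P * max h 0 * pathGain α R ‖y j‖) := by
      rw [hS, ENNReal.ofReal_sum_of_nonneg fun j _ => by have := hp j; positivity]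
      refine Finset.sum_le_sum fun j _ => ENNReal.ofReal_le_ofReal ?_
      have := hp j
      gcongr
      exact le_max_left _ _
    calc ulSINR α θ R P N x y u h g ≤ _ := ENNReal.toReal_mono
          (ENNReal.div_ne_top ENNReal.ofReal_ne_top (by simp [hN])) (ENNReal.div_le_div_right hle _)
      _ ≤ (∑ j ∈ F, P * max h 0 * pathGain α R ‖y j‖) / N := toReal_div_add_le h0 hN _
      _ = _ := by rw [Finset.sum_div]; exact Finset.sum_congr rfl fun j _ => by ring
  have h2 : ulCapacity α θ R P N (x, y, u, h, g) ≤
      ∑ j ∈ F, (P / N * max h 0 + logGainBound α R lam ‖y j‖) := by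
    refine (Real.log_le_log (by unfold ulSINR; positivity) (by gcongr)).trans
      ((log_one_add_sum_le F hb).trans (Finset.sum_le_sum fun j _ => ?_))
    exact log_one_add_mul_pathGain_le hα hlam (norm_nonneg _) (by positivity)
  refine (ENNReal.ofReal_le_ofReal h2).trans ?_
  rw [ENNReal.ofReal_sum_of_nonneg fun j _ => add_nonneg (by positivity) (hg j), one_mul,
    ← ENNReal.tsum_mul_left, ← ENNReal.tsum_add]
  refine le_trans (Finset.sum_le_sum fun j hj => ?_) (ENNReal.sum_le_tsum F)
  have hj' : y j ∈ originCell x := ((hF j).1 hj).1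
  rw [Set.indicator_of_mem hj', Set.indicator_of_mem hj', Pi.one_apply, mul_one,
    ENNReal.ofReal_add (by positivity) (hg j)]

section Network

variable {QB QU : Measure (ℕ → Plane)} {lamM lamU : ℝ}

theorem lintegral_ulCapacity_le {α θ R P N : ℝ} (hα : 0 < α) (hP : 0 < P) (hN : 0 < N)
    (hR : 0 ≤ R) (hM : 0 < lamM) (hU : 0 < lamU) (hQB : IsPoissonProcess QB lamM)
    (hQU : IsPoissonProcess QU lamU) :
    ∫⁻ s, ENNReal.ofReal (ulCapacity α θ R P N s) ∂(networkLaw QB QU) ≤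
      ENNReal.ofReal (lamU / lamM *
        (α / 2 * Real.posLog lamM * losProb lamM R + (P / N + 2 * Real.pi * α))) := by
  have := hQB.prob
  have := hQU.prob
  have hpl := Real.posLog_nonneg (x := lamM)
  have hlos := losProb_nonneg (R := R) hM.le
  have hpi := Real.pi_pos
  have hlg : Measurable fun z : Plane => ENNReal.ofReal (logGainBound α R lamM ‖z‖) :=
    ((measurable_logGainBound α R lamM).comp measurable_norm).ennreal_ofReal
  refine (lintegral_mono_ae ((ae_finite_originCell hQB hQU hM hU.le).mono fun s hs =>
    ofReal_ulCapacity_le (θ := θ) (R := R) hα hP hN hM hs)).trans ?_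
  have hm1 : Measurable fun s : Sample => ENNReal.ofReal (P / N * max s.2.2.2.1 0) *
      ∑' j, (originCell s.1).indicator (1 : Plane → ℝ≥0∞) (s.2.1 j) :=
    Measurable.mul (by fun_prop) (measurable_tsum_originCell measurable_one)
  rw [lintegral_add_left hm1, lintegral_tsum_originCell hQB hQU hM.le hU.le
    (f := (1 : Plane → ℝ≥0∞)) measurable_one (w := fun h => ENNReal.ofReal (P / N * max h 0))
    (by fun_prop), lintegral_tsum_originCell hQB hQU hM.le hU.le hlg (w := fun _ => 1)
    measurable_const]
  simp_rw [Pi.one_apply, mul_one, ENNReal.ofReal_mul (show 0 ≤ P / N by positivity)]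
  rw [lintegral_const_mul _ (by fun_prop), lintegral_max_expMeasure, lintegral_exp_neg_sq hM,
    lintegral_one, measure_univ, one_mul, mul_one]
  have h1 : ∀ z : Plane, ENNReal.ofReal (Real.exp (-(lamM * Real.pi * ‖z‖ ^ 2))) *
      ENNReal.ofReal (logGainBound α R lamM ‖z‖) ≤
      ENNReal.ofReal (α / 2 * Real.posLog lamM) *
        (Metric.closedBall (0 : Plane) R).indicator
          (fun z => ENNReal.ofReal (Real.exp (-(lamM * Real.pi * ‖z‖ ^ 2)))) z +
      (Metric.closedBall (0 : Plane) (√lamM)⁻¹).indicator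
        (fun z => ENNReal.ofReal (α * (√lamM)⁻¹) * ENNReal.ofReal ‖z‖⁻¹) z := by
    intro z
    rw [ofReal_logGainBound _ _ _ hα.le, mul_add]
    refine add_le_add (le_of_eq ?_) (mul_le_of_le_one_left' ?_)
    · by_cases hz : z ∈ Metric.closedBall (0 : Plane) R
      · rw [Set.indicator_of_mem hz, Set.indicator_of_mem hz, mul_comm]
      · rw [Set.indicator_of_notMem hz, Set.indicator_of_notMem hz, mul_zero, mul_zero]
    · rw [ENNReal.ofReal_le_one, Real.exp_le_one_iff, Left.neg_nonpos_iff]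
      positivity
  have h2 := lintegral_mono h1 (μ := volume)
  rw [lintegral_add_left ((Measurable.indicator (by fun_prop)
    Metric.isClosed_closedBall.measurableSet).const_mul _), lintegral_const_mul _
    (Measurable.indicator (by fun_prop) Metric.isClosed_closedBall.measurableSet),
    lintegral_indicator Metric.isClosed_closedBall.measurableSet,
    setLIntegral_exp_neg_sq_closedBall hM hR, lintegral_logGainBound_near hα.le hM] at h2
  refine (add_le_add_right (mul_le_mul_right h2 _) _).trans ?_
  change _ + _ * (_ * ENNReal.ofReal (losProb lamM R / lamM) + _) ≤ _
  rw [← ENNReal.ofReal_mul (by positivity), ← ENNReal.ofReal_mul (by positivity),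
    ← ENNReal.ofReal_mul (by positivity), ← ENNReal.ofReal_add (by positivity) (by positivity),
    ← ENNReal.ofReal_mul (by positivity), ← ENNReal.ofReal_add (by positivity) (by positivity)]
  exact ENNReal.ofReal_le_ofReal (le_of_eq (by field_simp; ring))

/-! ### Uplink: the interference -/

/-- `T` times this quantity bounds the uplink interference whenever the quantity is less than `1`,
as then there is no user outside the cell of the origin at distance at most `s`. -/
def ulInterferenceBound (α P s T : ℝ) (x y : ℕ → Plane) (g : ℕ → ℝ) : ℝ≥0∞ :=
  ∑' j, ((originCell x)ᶜ.indicator ((Metric.closedBall (0 : Plane) s).indicator 1) (y j) +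
    ENNReal.ofReal (P * g j) * (originCell x)ᶜ.indicator
      ((Metric.closedBall (0 : Plane) s)ᶜ.indicator
        fun z => ENNReal.ofReal (‖z‖ ^ (-α)) / ENNReal.ofReal T) (y j))

theorem one_le_ulInterferenceBound {α θ R P s T : ℝ} (hT : 0 < T)
    {x y : ℕ → Plane} (u : ℕ → unitInterval) (g : ℕ → ℝ)
    (htie : ∀ j, y j ∈ originCell x → ∀ i, ‖y j‖ < dist (y j) (x i))
    (hI : ENNReal.ofReal T < ulInterference α θ R P x y u g) :
    1 ≤ ulInterferenceBound α P s T x y g := by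
  by_cases h1 : ∃ j, y j ∈ Metric.closedBall (0 : Plane) s ∧ y j ∉ originCell x
  · obtain ⟨j, hj, hjC⟩ := h1
    refine le_trans ?_ (ENNReal.le_tsum j)
    rw [Set.indicator_of_mem (by exact hjC), Set.indicator_of_mem hj]
    exact le_self_add
  push Not at h1
  have hT0 : ENNReal.ofReal T ≠ 0 := by simp [hT]
  have h2 : ulInterference α θ R P x y u g ≤
      ENNReal.ofReal T * ulInterferenceBound α P s T x y g := by
    unfold ulInterference ulInterferenceBound
    rw [← ENNReal.tsum_mul_left]
    refine ENNReal.tsum_le_tsum fun j => ?_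
    split_ifs with hj
    swap
    · exact zero_le
    obtain ⟨i, ⟨hi, _⟩, _⟩ := hj
    have hjC : y j ∉ originCell x := by
      intro hjC
      have h3 := hi none
      have h4 := htie j hjC i
      simp only [withOrigin, Option.elim, dist_zero_right] at h3
      linarith
    have hjs : y j ∉ Metric.closedBall (0 : Plane) s := fun hjs => hjC (h1 j hjs)
    have hjC' : y j ∈ (originCell x)ᶜ := hjC
    have hjs' : y j ∈ (Metric.closedBall (0 : Plane) s)ᶜ := hjs
    simp only [Set.indicator_of_mem hjC', Set.indicator_of_notMem hjs, Set.indicator_of_mem hjs']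
    rw [zero_add, ENNReal.ofReal_mul' (pathGain_nonneg _ _ (norm_nonneg _)), mul_left_comm,
      ENNReal.mul_div_cancel hT0 ENNReal.ofReal_ne_top]
    gcongr
    exact pathGain_le _ _ (norm_nonneg _)
  by_contra hcon
  refine absurd (hI.trans_le h2) (not_lt.2 (mul_le_of_le_one_right' (not_le.1 hcon).le))

theorem measurable_ulInterferenceBound (α P s T : ℝ) :
    Measurable fun ω : Sample => ulInterferenceBound α P s T ω.1 ω.2.1 ω.2.2.2.2 := by
  have hB : MeasurableSet (Metric.closedBall (0 : Plane) s) :=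
    Metric.isClosed_closedBall.measurableSet
  have key : ∀ f : Plane → ℝ≥0∞, Measurable f → ∀ j,
      Measurable fun ω : Sample => (originCell ω.1)ᶜ.indicator f (ω.2.1 j) := fun f hf j =>
    ((hf.comp measurable_snd).indicator measurableSet_mem_originCell.compl).comp
      (g := {p : (ℕ → Plane) × Plane | p.2 ∈ originCell p.1}ᶜ.indicator (f ∘ Prod.snd))
      (f := fun ω : Sample => (ω.1, ω.2.1 j)) (by fun_prop)
  refine Measurable.tsum fun j => Measurable.add (key _ (measurable_one.indicator hB) j)
    (Measurable.mul (by fun_prop) (key _ (Measurable.indicator (by fun_prop) hB.compl) j))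

/-- Given the BSs, the users outside the cell of the origin do not depend on whether the BS at the
origin is active. -/
theorem networkLaw_hasUser_lt_ulInterference_le {α θ R P s T : ℝ} (hα : 2 < α) (hP : 0 < P)
    (hs : 0 < s) (hT : 0 < T) (hM : 0 < lamM) (hU : 0 < lamU) (hQB : IsPoissonProcess QB lamM)
    (hQU : IsPoissonProcess QU lamU) :
    networkLaw QB QU {ω | OriginCellHasUser ω.1 ω.2.1 ∧
        ENNReal.ofReal T < ulInterference α θ R P ω.1 ω.2.1 ω.2.2.1 ω.2.2.2.2} ≤
      ENNReal.ofReal (lamU / lamM * (lamU * (s ^ 2 * Real.pi) +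
        P * (2 * Real.pi / (α - 2)) * (lamU * s ^ (2 - α)) / T)) := by
  have := hQB.prob
  have := hQU.prob
  have hpi := Real.pi_pos
  have hα2 : 0 < α - 2 := by linarith
  have hB : MeasurableSet (Metric.closedBall (0 : Plane) s) :=
    Metric.isClosed_closedBall.measurableSet
  let A : (ℕ → Plane) → (ℕ → Plane) → ℝ≥0∞ := fun x =>
    {y | ∃ j, y j ∈ originCell x}.indicator 1
  have hA : ∀ x, MeasurableSet {y : ℕ → Plane | ∃ j, y j ∈ originCell x} := fun x =>
    measurableSet_originCellHasUser.preimage (f := fun y => (x, y)) (by fun_prop)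
  let Φ : Sample → ℝ≥0∞ := fun ω =>
    A ω.1 ω.2.1 * ulInterferenceBound α P s T ω.1 ω.2.1 ω.2.2.2.2
  have hΦ : Measurable Φ := ((measurable_one.indicator measurableSet_originCellHasUser).comp
      (g := {p : (ℕ → Plane) × (ℕ → Plane) | OriginCellHasUser p.1 p.2}.indicator 1)
      (f := fun ω : Sample => (ω.1, ω.2.1)) (by fun_prop)).mul
    (measurable_ulInterferenceBound α P s T)
  let f : Plane → ℝ≥0∞ := fun z => (Metric.closedBall (0 : Plane) s).indicator 1 z +
    ENNReal.ofReal P * (Metric.closedBall (0 : Plane) s)ᶜ.indicator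
        (fun z => ENNReal.ofReal (‖z‖ ^ (-α)) / ENNReal.ofReal T) z
  have hf1 : Measurable ((Metric.closedBall (0 : Plane) s).indicator (1 : Plane → ℝ≥0∞)) :=
    measurable_one.indicator hB
  have hf2 : Measurable ((Metric.closedBall (0 : Plane) s)ᶜ.indicator
      (fun z => ENNReal.ofReal (‖z‖ ^ (-α)) / ENNReal.ofReal T)) :=
    Measurable.indicator (by fun_prop) hB.compl
  have hf : Measurable f := hf1.add (hf2.const_mul _)
  have hfint : ∫⁻ z, f z = ENNReal.ofReal (s ^ 2 * Real.pi +
      P * (2 * Real.pi / (α - 2)) * s ^ (2 - α) / T) := by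
    simp only [f]
    rw [lintegral_add_left hf1, lintegral_indicator_one hB, lintegral_const_mul _ hf2,
      lintegral_indicator hB.compl]
    simp_rw [div_eq_mul_inv]
    rw [lintegral_mul_const _ (by fun_prop), ← div_eq_mul_inv, ← div_eq_mul_inv,
      setLIntegral_rpow_compl_closedBall hα hs,
      EuclideanSpace.volume_closedBall_fin_two, ← ENNReal.ofReal_pow hs.le,
      ← ENNReal.ofReal_mul (by positivity), ← ENNReal.ofReal_div_of_pos hT,
      ← ENNReal.ofReal_mul (by positivity), ← ENNReal.ofReal_add (by positivity) (by positivity)]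
    congr 1
    ring
  have hfC : ∀ x z, (originCell x)ᶜ.indicator f z =
      (originCell x)ᶜ.indicator ((Metric.closedBall (0 : Plane) s).indicator 1) z +
      ENNReal.ofReal P * (originCell x)ᶜ.indicator ((Metric.closedBall (0 : Plane) s)ᶜ.indicator
        (fun z => ENNReal.ofReal (‖z‖ ^ (-α)) / ENNReal.ofReal T)) z := by
    intro x z
    by_cases hz : z ∈ (originCell x)ᶜ
    · simp only [Set.indicator_of_mem hz, f]
    · simp only [Set.indicator_of_notMem hz, mul_zero, add_zero]
  have h1 : ∀ (x y : ℕ → Plane) (u : ℕ → unitInterval) (h : ℝ),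
      ∫⁻ g, Φ (x, y, u, h, g) ∂fadingLaw =
      A x y * ∑' j, (originCell x)ᶜ.indicator f (y j) := by
    intro x y u h
    have hm : ∀ j, Measurable fun g : ℕ → ℝ =>
        (originCell x)ᶜ.indicator ((Metric.closedBall (0 : Plane) s).indicator 1) (y j) +
        ENNReal.ofReal (P * g j) * (originCell x)ᶜ.indicator
          ((Metric.closedBall (0 : Plane) s)ᶜ.indicator
            fun z => ENNReal.ofReal (‖z‖ ^ (-α)) / ENNReal.ofReal T) (y j) := fun j => by fun_prop
    simp only [Φ, ulInterferenceBound]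
    rw [lintegral_const_mul _ (Measurable.tsum hm),
      lintegral_tsum fun j => (hm j).aemeasurable]
    congr 1
    refine tsum_congr fun j => ?_
    rw [lintegral_add_left measurable_const, lintegral_const, measure_univ, mul_one,
      lintegral_mul_const _ (by fun_prop), lintegral_fadingLaw_eval P hP.le, hfC]
  have h2 : ∀ᵐ x ∂QB, ∫⁻ y, A x y * ∑' j, (originCell x)ᶜ.indicator f (y j) ∂QU ≤
      QU {y | ∃ j, y j ∈ originCell x} * (ENNReal.ofReal lamU * ∫⁻ z, f z) := by
    filter_upwards [ae_volume_originCell_ne_top hQB hM] with x hx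
    have h3 : ∀ y : ℕ → Plane, A x y * ∑' j, (originCell x)ᶜ.indicator f (y j) =
        {y | ∃ j, y j ∈ originCell x}.indicator
          (fun y => ∑' j, (originCell x)ᶜ.indicator f (y j)) y := by
      intro y
      by_cases hy : y ∈ {y : ℕ → Plane | ∃ j, y j ∈ originCell x}
      · simp only [A, Set.indicator_of_mem hy, Pi.one_apply, one_mul]
      · simp only [A, Set.indicator_of_notMem hy, zero_mul]
    simp_rw [h3]
    rw [lintegral_indicator (hA x),
      hQU.setLIntegral_exists_tsum hU.le (measurableSet_originCell x) hx hf]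
    gcongr
    exact Measure.restrict_le_self
  have h4 : ∫⁻ ω, Φ ω ∂(networkLaw QB QU) ≤
      ENNReal.ofReal (lamU / lamM) * (ENNReal.ofReal lamU * ∫⁻ z, f z) := by
    rw [lintegral_networkLaw hΦ]
    simp_rw [h1, lintegral_const, measure_univ, mul_one]
    refine (lintegral_mono_ae h2).trans ?_
    have hm : Measurable fun x : ℕ → Plane => QU {y | ∃ j, y j ∈ originCell x} :=
      measurable_measure_prodMk_left measurableSet_originCellHasUser
    rw [lintegral_mul_const _ hm]
    gcongr
    rw [← networkLaw_hasUser_eq]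
    exact networkLaw_hasUser_le hQB hQU hM hU.le
  have h5 : networkLaw QB QU {ω | 1 ≤ Φ ω} ≤ ∫⁻ ω, Φ ω ∂(networkLaw QB QU) := by
    simpa using mul_meas_ge_le_lintegral (μ := networkLaw QB QU) hΦ 1
  refine le_trans (measure_mono_ae ?_) (h5.trans (h4.trans (le_of_eq ?_)))
  · filter_upwards [ae_norm_lt_dist hQB hQU hM hU.le] with ω htie ⟨hω, hI⟩
    have h6 := one_le_ulInterferenceBound (s := s) hT _ _ htie hI
    have h7 : A ω.1 ω.2.1 = 1 := Set.indicator_of_mem (by exact hω) _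
    change 1 ≤ A ω.1 ω.2.1 * _
    rwa [h7, one_mul]
  · rw [hfint, ← ENNReal.ofReal_mul hU.le, ← ENNReal.ofReal_mul (by positivity)]
    congr 1
    ring

/-! ### Uplink: lower bound -/

theorem guaranteedCapacity_le_ulCapacity {α θ R P N δ ρ T : ℝ} (hα : 0 < α) (hP : 0 < P)
    (hN : 0 < N) (hδ : 0 ≤ δ) (hρ : 0 < ρ) (hρR : ρ ≤ R) (hT : 0 ≤ T) {ω : Sample}
    (hfin : {j | ω.2.1 j ∈ originCell ω.1}.Finite)
    (hact : OriginCellHasUser ω.1 ω.2.1) (h1 : ∀ j, ω.2.1 j ≠ 0)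
    (h2 : ∀ j, ω.2.1 j ∈ originCell ω.1 → ‖ω.2.1 j‖ ≤ ρ) (h3 : δ ≤ ω.2.2.2.1)
    (h4 : ulInterference α θ R P ω.1 ω.2.1 ω.2.2.1 ω.2.2.2.2 ≤ ENNReal.ofReal T) :
    guaranteedCapacity α P N δ ρ T ≤ ulCapacity α θ R P N ω := by
  obtain ⟨x, y, u, h, g⟩ := ω
  dsimp only at *
  obtain ⟨F, hF, hS⟩ := ulSignal_eq_sum (α := α) (R := R) (P := P) u h hfin
  obtain ⟨j, hj⟩ := originActive_of_hasUser (u := u) hfin hact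
  refine Real.log_le_log (by positivity) ?_
  gcongr
  refine le_toReal_div_add hN hT ?_ ?_ h4
  · rw [hS]
    exact ENNReal.sum_ne_top.2 fun _ _ => ENNReal.ofReal_ne_top
  · rw [hS]
    refine le_trans (ENNReal.ofReal_le_ofReal ?_) (Finset.single_le_sum
      (f := fun j => ENNReal.ofReal (P * h * pathGain α R ‖y j‖)) (fun _ _ => zero_le)
      ((hF j).2 hj))
    have h5 := h2 j hj.1
    rw [pathGain, if_pos (h5.trans hρR)]
    have : ρ ^ (-α) ≤ ‖y j‖ ^ (-α) :=
      Real.rpow_le_rpow_of_nonpos (norm_pos_iff.2 (h1 j)) h5 (by linarith)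
    have : 0 < ρ ^ (-α) := by positivity
    have : P * δ ≤ P * h := by gcongr
    have : 0 ≤ P * δ := by positivity
    gcongr
    linarith

/-- When the typical BS has users, the capacity is as guaranteed except for an event whose
probability is small compared with `lamU / lamM`. The requirement on the length is imposed on all
users in the cell, since the selected one need not be known. -/
theorem networkLaw_hasUser_guaranteedCapacity_le {α θ R P N s δ ρ T : ℝ} (hα : 2 < α) (hP : 0 < P)
    (hN : 0 < N) (hs : 0 < s) (hδ : 0 ≤ δ) (hρ : 0 < ρ) (hρR : ρ ≤ R)
    (hT : 0 < T) (hM : 0 < lamM) (hU : 0 < lamU) (hQB : IsPoissonProcess QB lamM)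
    (hQU : IsPoissonProcess QU lamU) :
    networkLaw QB QU {ω | OriginCellHasUser ω.1 ω.2.1} ≤
      networkLaw QB QU {ω | OriginCellHasUser ω.1 ω.2.1 ∧
        guaranteedCapacity α P N δ ρ T ≤ ulCapacity α θ R P N ω} +
      ENNReal.ofReal (lamU / lamM * (Real.exp (-(lamM * Real.pi * ρ ^ 2)) + δ +
        (lamU * (s ^ 2 * Real.pi) + P * (2 * Real.pi / (α - 2)) * (lamU * s ^ (2 - α)) / T))) := by
  have := hQB.prob
  have := hQU.prob
  have hpi := Real.pi_pos
  have hα2 : 0 < α - 2 := by linarith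
  have hB : MeasurableSet (Metric.closedBall (0 : Plane) ρ) :=
    Metric.isClosed_closedBall.measurableSet
  have h1 : networkLaw QB QU {ω | (1 : ℝ≥0∞) ≤ ∑' j, (originCell ω.1).indicator
      ((Metric.closedBall (0 : Plane) ρ)ᶜ.indicator 1) (ω.2.1 j)} ≤
      ENNReal.ofReal (lamU / lamM * Real.exp (-(lamM * Real.pi * ρ ^ 2))) := by
    have hf : Measurable ((Metric.closedBall (0 : Plane) ρ)ᶜ.indicator (1 : Plane → ℝ≥0∞)) :=
      measurable_one.indicator hB.compl
    have h := lintegral_tsum_originCell hQB hQU hM.le hU.le hf (w := fun _ => 1) measurable_const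
    have hmk := mul_meas_ge_le_lintegral (μ := networkLaw QB QU) (measurable_tsum_originCell hf) 1
    simp only [one_mul] at h hmk
    refine hmk.trans (h.le.trans (le_of_eq ?_))
    have h2 : ∀ z : Plane, ENNReal.ofReal (Real.exp (-(lamM * Real.pi * ‖z‖ ^ 2))) *
        (Metric.closedBall (0 : Plane) ρ)ᶜ.indicator 1 z =
        (Metric.closedBall (0 : Plane) ρ)ᶜ.indicator
          (fun z => ENNReal.ofReal (Real.exp (-(lamM * Real.pi * ‖z‖ ^ 2)))) z := by
      intro z
      by_cases hz : z ∈ (Metric.closedBall (0 : Plane) ρ)ᶜ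
      · simp only [Set.indicator_of_mem hz, Pi.one_apply, mul_one]
      · simp only [Set.indicator_of_notMem hz, mul_zero]
    simp_rw [h2]
    rw [lintegral_indicator hB.compl, setLIntegral_exp_neg_sq_compl_closedBall hM hρ.le,
      lintegral_one, measure_univ, one_mul, ← ENNReal.ofReal_mul hU.le]
    congr 1
    ring
  have h2 : networkLaw QB QU {ω | (1 : ℝ≥0∞) ≤ (Set.Iic δ).indicator 1 ω.2.2.2.1 *
      ∑' j, (originCell ω.1).indicator 1 (ω.2.1 j)} ≤ ENNReal.ofReal (lamU / lamM * δ) := by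
    have hw : Measurable ((Set.Iic δ).indicator (1 : ℝ → ℝ≥0∞)) :=
      measurable_one.indicator measurableSet_Iic
    have h := lintegral_tsum_originCell hQB hQU hM.le hU.le (f := 1) measurable_one hw
    have hm : Measurable fun ω : Sample => (Set.Iic δ).indicator (1 : ℝ → ℝ≥0∞) ω.2.2.2.1 *
      ∑' j, (originCell ω.1).indicator (1 : Plane → ℝ≥0∞) (ω.2.1 j) :=
      (hw.comp (f := fun ω : Sample => ω.2.2.2.1) (by fun_prop)).mul
        (measurable_tsum_originCell measurable_one)
    have hmk := mul_meas_ge_le_lintegral (μ := networkLaw QB QU) hm 1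
    simp only [one_mul] at hmk
    refine hmk.trans (h.le.trans ?_)
    simp only [Pi.one_apply, mul_one]
    rw [lintegral_indicator_one measurableSet_Iic, lintegral_exp_neg_sq hM,
      ← ENNReal.ofReal_mul hU.le, mul_one_div, mul_comm, ENNReal.ofReal_mul (by positivity)]
    gcongr
    exact expMeasure_one_Iic_le hδ
  have h3 := networkLaw_hasUser_lt_ulInterference_le (θ := θ) (R := R) hα hP hs hT hM hU hQB hQU
  have hae : ∀ᵐ ω ∂(networkLaw QB QU), ∀ j, ω.2.1 j ∉ ({0} : Set Plane) :=
    (measurePreserving_users QB QU).quasiMeasurePreserving.ae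
      (hQU.ae_notMem hU.le (measurableSet_singleton 0) (by simp))
  rw [mul_add, mul_add, ENNReal.ofReal_add (by positivity) (by positivity),
    ENNReal.ofReal_add (by positivity) (by positivity)]
  refine le_trans ?_ (add_le_add_right (add_le_add (add_le_add h1 h2) h3) _)
  refine le_trans (measure_mono_ae ?_) ((measure_union_le _ _).trans
    (add_le_add_right ((measure_union_le _ _).trans
      (add_le_add_left (measure_union_le _ _) _)) _))
  filter_upwards [hae, ae_finite_originCell hQB hQU hM hU.le] with ω h0 hfin hω
  by_contra hcon
  change ¬ (_ ∨ (_ ∨ _) ∨ _) at hcon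
  rw [not_or, not_or, not_or] at hcon
  obtain ⟨c1, ⟨c2, c3⟩, c4⟩ := hcon
  refine c1 ⟨hω, guaranteedCapacity_le_ulCapacity (by linarith) hP hN hδ hρ hρR hT.le hfin hω h0
    (fun j hj => ?_) ?_ (not_lt.1 fun hI => c4 ⟨hω, hI⟩)⟩
  · by_contra hjρ
    have hj' : ω.2.1 j ∈ (Metric.closedBall (0 : Plane) ρ)ᶜ := by simpa using hjρ
    refine c2 ?_
    change (1 : ℝ≥0∞) ≤ ∑' _, _
    refine le_trans ?_ (ENNReal.le_tsum j)
    rw [Set.indicator_of_mem hj, Set.indicator_of_mem hj', Pi.one_apply]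
  · by_contra hh
    refine c3 ?_
    obtain ⟨j, hj⟩ := hω
    change (1 : ℝ≥0∞) ≤ _ * _
    rw [Set.indicator_of_mem (show ω.2.2.2.1 ∈ Set.Iic δ from (not_le.1 hh).le), Pi.one_apply,
      one_mul]
    refine le_trans ?_ (ENNReal.le_tsum j)
    rw [Set.indicator_of_mem hj, Pi.one_apply]

end Network

/-! ### Bounds for the spectral efficiencies -/

section Parameters

/-- The maximal length of the links that the lower bounds count. No BS is within the second term of
the minimum with probability `exp (-1 / ε)`. -/
def goodRadius (R lamM ε : ℝ) : ℝ := min R (√(1 / (ε * (lamM * Real.pi))))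

/-- The interference level that the lower bounds allow. The users outside a disc of radius
`ε / √lamU` cause an interference of the order of `ε ^ 2` times this level, see
`interference_scaling`. -/
def interferenceLevel (α lamU ε : ℝ) : ℝ := lamU ^ (α / 2) * ε ^ (-α)

/-- A bound for the loss of probability in the lower bounds, downlink and uplink, where `ratio` is
the ratio of the densities of BSs and users. -/
def probLoss (α P ratio ε : ℝ) : ℝ :=
  2 * ε + (Real.pi + 2 * P * 2 ^ α * (2 * Real.pi / (α - 2))) * ε ^ 2 + 4 / ratio

variable {α P N R lamM lamU ε : ℝ}

theorem exp_neg_goodRadius_le (hM : 0 < lamM) (hε : 0 < ε) :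
    Real.exp (-(lamM * Real.pi * goodRadius R lamM ε ^ 2)) ≤ 1 - losProb lamM R + ε := by
  have hpi := Real.pi_pos
  unfold goodRadius losProb
  rcases le_total R (√(1 / (ε * (lamM * Real.pi)))) with h | h
  · rw [min_eq_left h]; linarith
  · rw [min_eq_right h, Real.sq_sqrt (by positivity)]
    have h1 : lamM * Real.pi * (1 / (ε * (lamM * Real.pi))) = ε⁻¹ := by field_simp
    rw [h1]
    have h2 : Real.exp (-ε⁻¹) ≤ ε := by
      rw [Real.exp_neg]
      refine inv_le_of_inv_le₀ hε ?_
      linarith [Real.add_one_le_exp ε⁻¹]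
    have := Real.exp_pos (-(lamM * Real.pi * R ^ 2))
    linarith

/-- With `s = ε / √lamU`, the mean interference `lamU * s ^ (2 - α)` of the users beyond `s` is
small compared with `interferenceLevel`. -/
theorem interference_scaling (hU : 0 < lamU) (hε : 0 < ε) :
    lamU * (ε / √lamU) ^ (2 - α) / interferenceLevel α lamU ε = ε ^ 2 := by
  have hs : 0 < √lamU := Real.sqrt_pos.2 hU
  unfold interferenceLevel
  rw [Real.div_rpow hε.le hs.le, Real.sqrt_eq_rpow, ← Real.rpow_mul hU.le]
  have h1 : lamU = lamU ^ (1 / 2 * (2 - α)) * lamU ^ (α / 2) := by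
    rw [← Real.rpow_add hU, show 1 / 2 * (2 - α) + α / 2 = 1 by ring, Real.rpow_one]
  have h2 : ε ^ (2 - α) = ε ^ 2 * ε ^ (-α) := by
    rw [sub_eq_add_neg, Real.rpow_add hε, Real.rpow_two]
  have h3 : 0 < lamU ^ (α / 2) := Real.rpow_pos_of_pos hU _
  have h4 : 0 < lamU ^ (1 / 2 * (2 - α)) := Real.rpow_pos_of_pos hU _
  have h5 : 0 < ε ^ (-α) := Real.rpow_pos_of_pos hε _
  rw [h2]
  generalize lamU ^ (1 / 2 * (2 - α)) = a at *
  generalize lamU ^ (α / 2) = b at *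
  generalize ε ^ (-α) = c at *
  rw [h1]
  field_simp

/-- The logarithmic dependence on the parameters; only the first term is of leading order. -/
theorem le_guaranteedCapacity (hα : 0 < α) (hP : 0 < P) (hN : 0 < N) (hR : 0 < R) (hM : 0 < lamM)
    (hU : 0 < lamU) (hε : 0 < ε) :
    α / 2 * Real.log (lamM / lamU) - α * |Real.log lamU| - (1 + 3 * α / 2) * |Real.log ε| -
      (|Real.log P| + Real.log (1 + N)) ≤
      guaranteedCapacity α P N ε (goodRadius R lamM ε) (interferenceLevel α lamU ε) := by
  have hpi := Real.pi_pos
  set T := interferenceLevel α lamU ε with hT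
  have hT0 : 0 < T := mul_pos (Real.rpow_pos_of_pos hU _) (Real.rpow_pos_of_pos hε _)
  have hρ : 0 < goodRadius R lamM ε := lt_min hR (Real.sqrt_pos.2 (by positivity))
  have h1 : (ε * (lamM * Real.pi)) ^ (α / 2) ≤ goodRadius R lamM ε ^ (-α) := by
    have h2 : goodRadius R lamM ε ≤ √(1 / (ε * (lamM * Real.pi))) := min_le_right _ _
    refine le_trans (le_of_eq ?_) (Real.rpow_le_rpow_of_nonpos hρ h2 (by linarith))
    rw [Real.sqrt_eq_rpow, ← Real.rpow_mul (by positivity), one_div, Real.inv_rpow (by positivity),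
      ← Real.rpow_neg (by positivity)]
    congr 1; ring
  have hx : 0 < (ε * (lamM * Real.pi)) ^ (α / 2) := by positivity
  have h2 : T + N ≤ max 1 T * (1 + N) := by
    nlinarith [le_max_left 1 T, le_max_right 1 T]
  have h3 : Real.log (T + N) ≤ |Real.log T| + Real.log (1 + N) := by
    refine (Real.log_le_log (by positivity) h2).trans ?_
    rw [Real.log_mul (by positivity) (by positivity), ← abs_of_pos hT0, ← Real.posLog_eq_log_max_one
      (abs_nonneg _), Real.posLog, abs_of_pos hT0]
    gcongr
    exact max_le (abs_nonneg _) (le_abs_self _)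
  have h4 : |Real.log T| ≤ α / 2 * |Real.log lamU| + α * |Real.log ε| := by
    rw [hT, interferenceLevel, Real.log_mul (by positivity) (by positivity), Real.log_rpow hU,
      Real.log_rpow hε]
    refine (abs_add_le _ _).trans ?_
    rw [abs_mul, abs_mul, abs_neg, abs_of_pos hα, abs_of_pos (half_pos hα)]
  have h5 : Real.log (P * ε * (ε * (lamM * Real.pi)) ^ (α / 2) / (T + N)) ≤
      guaranteedCapacity α P N ε (goodRadius R lamM ε) T := by
    refine Real.log_le_log (by positivity) ?_
    have : P * ε * (ε * (lamM * Real.pi)) ^ (α / 2) / (T + N) ≤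
        P * ε * goodRadius R lamM ε ^ (-α) / (T + N) := by gcongr
    linarith
  refine le_trans ?_ h5
  rw [Real.log_div hM.ne' hU.ne', Real.log_div (by positivity) (by positivity),
    Real.log_mul (by positivity) (by positivity), Real.log_mul hP.ne' hε.ne',
    Real.log_rpow (by positivity), Real.log_mul hε.ne' (by positivity),
    Real.log_mul hM.ne' hpi.ne']
  have h6 : 0 ≤ Real.log Real.pi := Real.log_nonneg (by linarith [Real.pi_gt_three])
  have h7 := neg_abs_le (Real.log P)
  have h8 := neg_abs_le (Real.log ε)
  have h9 := neg_abs_le (Real.log lamU)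
  have h10 := mul_le_mul_of_nonneg_left h8 hα.le
  have h11 := mul_le_mul_of_nonneg_left h9 hα.le
  have h12 := mul_nonneg hα.le h6
  linarith

end Parameters

section SpectralEfficiency

variable {QB QU : Measure (ℕ → Plane)} {lamM lamU α θ P N R : ℝ}

theorem integrable_dlCapacity (hα : 0 < α) (hP : 0 < P) (hN : 0 < N)
    (hR : 0 ≤ R) (hM : 0 < lamM) (hQB : IsPoissonProcess QB lamM) [IsProbabilityMeasure QU] :
    Integrable (dlCapacity α θ R P N) (networkLaw QB QU) := by
  refine ⟨(measurable_dlCapacity α θ R P N).aestronglyMeasurable, ?_⟩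
  rw [hasFiniteIntegral_iff_ofReal (Eventually.of_forall fun s => dlCapacity_nonneg α θ R P N s)]
  exact (lintegral_dlCapacity_le hα hP hN hR hM hQB).trans_lt ENNReal.ofReal_lt_top

theorem integrable_ulCapacity (hα : 0 < α) (hP : 0 < P) (hN : 0 < N)
    (hR : 0 ≤ R) (hM : 0 < lamM) (hU : 0 < lamU) (hQB : IsPoissonProcess QB lamM)
    (hQU : IsPoissonProcess QU lamU) :
    Integrable (ulCapacity α θ R P N) (networkLaw QB QU) := by
  refine ⟨(measurable_ulCapacity α θ R P N).aestronglyMeasurable, ?_⟩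
  rw [hasFiniteIntegral_iff_ofReal (Eventually.of_forall fun s => ulCapacity_nonneg α θ R P N s)]
  exact (lintegral_ulCapacity_le hα hP hN hR hM hU hQB hQU).trans_lt ENNReal.ofReal_lt_top

theorem integrable_ulCapacity_activeLaw (hα : 0 < α) (hP : 0 < P) (hN : 0 < N)
    (hR : 0 ≤ R) (hM : 0 < lamM) (hU : 0 < lamU) (hQB : IsPoissonProcess QB lamM)
    (hQU : IsPoissonProcess QU lamU) :
    Integrable (ulCapacity α θ R P N) (activeLaw QB QU) := by
  unfold activeLaw ProbabilityTheory.cond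
  by_cases h0 : networkLaw QB QU {s | OriginActive s.1 s.2.1 s.2.2.1} = 0
  · -- Conditioning on a null event gives the zero measure.
    rw [Measure.restrict_eq_zero.2 h0, smul_zero]
    exact integrable_zero_measure
  · exact (integrable_ulCapacity hα hP hN hR hM hU hQB hQU).integrableOn.smul_measure
      (ENNReal.inv_ne_top.2 h0)

theorem seDL_le (hα : 0 < α) (hP : 0 < P) (hN : 0 < N)
    (hR : 0 ≤ R) (hM : 0 < lamM) (hQB : IsPoissonProcess QB lamM) [IsProbabilityMeasure QU] :
    seDL α θ R P N QB QU ≤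
      α / 2 * Real.posLog lamM * losProb lamM R + (P / N + 2 * Real.pi * α) := by
  have hpl := Real.posLog_nonneg (x := lamM)
  have hlos := losProb_nonneg (R := R) hM.le
  have hpi := Real.pi_pos
  unfold seDL
  rw [integral_eq_lintegral_of_nonneg_ae (Eventually.of_forall fun s =>
    dlCapacity_nonneg α θ R P N s) (measurable_dlCapacity α θ R P N).aestronglyMeasurable]
  exact ENNReal.toReal_le_of_le_ofReal (by positivity) (lintegral_dlCapacity_le hα hP hN hR hM hQB)

theorem le_seDL {ε : ℝ} (hα : 2 < α) (hP : 0 < P) (hN : 0 < N) (hR : 0 < R) (hM : 0 < lamM)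
    (hU : 0 < lamU) (hQB : IsPoissonProcess QB lamM) (hQU : IsPoissonProcess QU lamU)
    (hε : 0 < ε) :
    (losProb lamM R - probLoss α P (lamM / lamU) ε) *
      guaranteedCapacity α P N ε (goodRadius R lamM ε) (interferenceLevel α lamU ε) ≤
      seDL α θ R P N QB QU := by
  have := hQB.prob
  have := hQU.prob
  have hpi := Real.pi_pos
  have hα2 : 0 < α - 2 := by linarith
  have hT : 0 < interferenceLevel α lamU ε :=
    mul_pos (Real.rpow_pos_of_pos hU _) (Real.rpow_pos_of_pos hε _)
  have hs : 0 < ε / √lamU := div_pos hε (Real.sqrt_pos.2 hU)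
  have hρ : 0 < goodRadius R lamM ε := lt_min hR (Real.sqrt_pos.2 (by positivity))
  set c := guaranteedCapacity α P N ε (goodRadius R lamM ε) (interferenceLevel α lamU ε) with hc
  have hc0 : 0 ≤ c := guaranteedCapacity_nonneg hP.le hN.le hε.le hρ.le hT.le
  have h1 := networkLaw_guaranteedCapacity_le (θ := θ) hα hP hN hs hε.le hρ
    (min_le_left _ _) hT hM hU hQB hQU
  rw [← hc, mul_div_assoc, interference_scaling hU hε, div_pow, Real.sq_sqrt hU.le] at h1
  have he : 0 ≤ 1 - Real.exp (-(lamM * Real.pi * goodRadius R lamM ε ^ 2)) := by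
    rw [sub_nonneg, Real.exp_le_one_iff, Left.neg_nonpos_iff]; positivity
  have h2 := ENNReal.toReal_mono (by finiteness) h1
  rw [ENNReal.toReal_add (measure_ne_top _ _) (by finiteness),
    ENNReal.toReal_add (by finiteness) (by finiteness), ENNReal.toReal_ofReal he,
    ENNReal.toReal_ofReal hε.le,
    ENNReal.toReal_ofReal (by positivity)] at h2
  have h3 : lamU * (ε ^ 2 / lamU * Real.pi) + lamU * (1 / (lamM / 4)) =
      Real.pi * ε ^ 2 + 4 / (lamM / lamU) := by field_simp
  rw [h3] at h2
  have h5 := exp_neg_goodRadius_le (R := R) hM hε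
  have h6 : losProb lamM R - probLoss α P (lamM / lamU) ε ≤
      (networkLaw QB QU).real {ω | c ≤ dlCapacity α θ R P N ω} := by
    unfold probLoss
    rw [measureReal_def]
    linarith
  -- Markov's inequality turns the probability of the good event into a bound for the mean.
  have h7 := mul_meas_ge_le_integral_of_nonneg (Eventually.of_forall fun s =>
    dlCapacity_nonneg α θ R P N s) (integrable_dlCapacity (θ := θ) (QU := QU) (by linarith) hP hN
      hR.le hM hQB) c
  refine le_trans ?_ h7
  rw [mul_comm]
  exact mul_le_mul_of_nonneg_left h6 hc0

/-- The probability that the typical BS is active. -/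
theorem activeProb_bounds (hM : 0 < lamM)
    (hU : 0 < lamU) (hQB : IsPoissonProcess QB lamM) (hQU : IsPoissonProcess QU lamU) :
    (networkLaw QB QU).real {s | OriginActive s.1 s.2.1 s.2.2.1} ≤ (lamM / lamU)⁻¹ ∧
    (lamM / lamU)⁻¹ * (1 - 2 / (lamM / lamU)) ≤
      (networkLaw QB QU).real {s | OriginActive s.1 s.2.1 s.2.2.1} := by
  have := hQB.prob
  have := hQU.prob
  rw [measureReal_def, originActive_ae_eq hQB hQU hM hU.le]
  constructor
  · rw [inv_div]
    exact ENNReal.toReal_le_of_le_ofReal (by positivity) (networkLaw_hasUser_le hQB hQU hM hU.le)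
  · have h1 := ENNReal.toReal_mono (by finiteness) (le_networkLaw_hasUser_add hQB hQU hM hU.le)
    rw [ENNReal.toReal_add (measure_ne_top _ _) (by finiteness),
      ENNReal.toReal_ofReal (by positivity), ENNReal.toReal_ofReal (by positivity)] at h1
    have h2 : (lamM / lamU)⁻¹ * (1 - 2 / (lamM / lamU)) = lamU / lamM - 2 * (lamU / lamM) ^ 2 := by
      field_simp
    linarith

theorem seUL_eq : seUL α θ R P N QB QU =
    ((networkLaw QB QU).real {s | OriginActive s.1 s.2.1 s.2.2.1})⁻¹ *
      ∫ s in {s | OriginActive s.1 s.2.1 s.2.2.1}, ulCapacity α θ R P N s ∂(networkLaw QB QU) := by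
  unfold seUL activeLaw ProbabilityTheory.cond
  rw [integral_smul_measure, ENNReal.toReal_inv, smul_eq_mul, measureReal_def]

/-- Dividing by the probability of activity cancels the factor `lamU / lamM` of
`lintegral_ulCapacity_le`, up to the factor `1 - 2 / (lamM / lamU)`. -/
theorem seUL_le (hα : 0 < α) (hP : 0 < P) (hN : 0 < N)
    (hR : 0 ≤ R) (hM : 0 < lamM) (hU : 0 < lamU) (hQB : IsPoissonProcess QB lamM)
    (hQU : IsPoissonProcess QU lamU) (hMU : 2 < lamM / lamU) :
    seUL α θ R P N QB QU ≤
      (α / 2 * Real.posLog lamM * losProb lamM R + (P / N + 2 * Real.pi * α)) /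
        (1 - 2 / (lamM / lamU)) := by
  have hpl := Real.posLog_nonneg (x := lamM)
  have hlos := losProb_nonneg (R := R) hM.le
  have hpi := Real.pi_pos
  have hr : 0 < lamM / lamU := by positivity
  have hd : 0 < 1 - 2 / (lamM / lamU) := by rw [sub_pos, div_lt_one hr]; exact hMU
  obtain ⟨_, hp⟩ := activeProb_bounds hM hU hQB hQU
  set p := (networkLaw QB QU).real {s | OriginActive s.1 s.2.1 s.2.2.1}
  have hint := integrable_ulCapacity (θ := θ) hα hP hN hR hM hU hQB hQU
  set B := α / 2 * Real.posLog lamM * losProb lamM R + (P / N + 2 * Real.pi * α) with hB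
  have hB0 : 0 ≤ B := by positivity
  have h1 : ∫ s, ulCapacity α θ R P N s ∂(networkLaw QB QU) ≤ (lamM / lamU)⁻¹ * B := by
    rw [integral_eq_lintegral_of_nonneg_ae (Eventually.of_forall fun s =>
      ulCapacity_nonneg α θ R P N s) (measurable_ulCapacity α θ R P N).aestronglyMeasurable,
      inv_div]
    exact ENNReal.toReal_le_of_le_ofReal (by positivity)
      (lintegral_ulCapacity_le hα hP hN hR hM hU hQB hQU)
  have h2 : ∫ s in {s | OriginActive s.1 s.2.1 s.2.2.1}, ulCapacity α θ R P N s
      ∂(networkLaw QB QU) ≤ (lamM / lamU)⁻¹ * B :=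
    (setIntegral_le_integral hint
      (Eventually.of_forall fun s => ulCapacity_nonneg α θ R P N s)).trans h1
  rw [seUL_eq]
  have hp' : 0 < (lamM / lamU)⁻¹ * (1 - 2 / (lamM / lamU)) := by positivity
  calc p⁻¹ * _ ≤ ((lamM / lamU)⁻¹ * (1 - 2 / (lamM / lamU)))⁻¹ * ((lamM / lamU)⁻¹ * B) := by
        refine mul_le_mul (inv_anti₀ hp' hp) h2 ?_ (by positivity)
        exact integral_nonneg fun s => ulCapacity_nonneg α θ R P N s
    _ = _ := by rw [mul_inv]; field_simp

theorem le_seUL {ε : ℝ} (hα : 2 < α) (hP : 0 < P) (hN : 0 < N) (hR : 0 < R) (hM : 0 < lamM)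
    (hU : 0 < lamU) (hQB : IsPoissonProcess QB lamM) (hQU : IsPoissonProcess QU lamU)
    (hε : 0 < ε) (hMU : 2 < lamM / lamU)
    (hpos : 0 ≤ losProb lamM R - probLoss α P (lamM / lamU) ε) :
    (losProb lamM R - probLoss α P (lamM / lamU) ε) *
      guaranteedCapacity α P N ε (goodRadius R lamM ε) (interferenceLevel α lamU ε) ≤
      seUL α θ R P N QB QU := by
  have := hQB.prob
  have := hQU.prob
  have hpi := Real.pi_pos
  have hα2 : 0 < α - 2 := by linarith
  have hr : 0 < lamM / lamU := by positivity
  have hd : 0 < 1 - 2 / (lamM / lamU) := by rw [sub_pos, div_lt_one hr]; exact hMU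
  have hT : 0 < interferenceLevel α lamU ε :=
    mul_pos (Real.rpow_pos_of_pos hU _) (Real.rpow_pos_of_pos hε _)
  have hs : 0 < ε / √lamU := div_pos hε (Real.sqrt_pos.2 hU)
  have hρ : 0 < goodRadius R lamM ε := lt_min hR (Real.sqrt_pos.2 (by positivity))
  set c := guaranteedCapacity α P N ε (goodRadius R lamM ε) (interferenceLevel α lamU ε) with hc
  have hc0 : 0 ≤ c := guaranteedCapacity_nonneg hP.le hN.le hε.le hρ.le hT.le
  obtain ⟨hp1, hp2⟩ := activeProb_bounds hM hU hQB hQU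
  have hp0 : 0 < (networkLaw QB QU).real {s | OriginActive s.1 s.2.1 s.2.2.1} :=
    lt_of_lt_of_le (by positivity) hp2
  have h1 := networkLaw_hasUser_guaranteedCapacity_le (θ := θ) hα hP hN hs hε.le hρ
    (min_le_left _ _) hT hM hU hQB hQU
  rw [← hc, mul_div_assoc, interference_scaling hU hε, div_pow, Real.sq_sqrt hU.le,
    ← originActive_ae_eq hQB hQU hM hU.le] at h1
  have h2 := ENNReal.toReal_mono (by finiteness) h1
  rw [ENNReal.toReal_add (measure_ne_top _ _) (by finiteness),
    ENNReal.toReal_ofReal (by positivity), ← inv_div lamM lamU,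
    show lamU * (ε ^ 2 / lamU * Real.pi) = Real.pi * ε ^ 2 by field_simp] at h2
  have h5 := exp_neg_goodRadius_le (R := R) hM hε
  have hA : MeasurableSet {s : Sample | OriginActive s.1 s.2.1 s.2.2.1} :=
    measurableSet_originActive (by fun_prop) (by fun_prop) (by fun_prop)
  let μA := (networkLaw QB QU).restrict {s | OriginActive s.1 s.2.1 s.2.2.1}
  have hgood : networkLaw QB QU {ω | OriginCellHasUser ω.1 ω.2.1 ∧ c ≤ ulCapacity α θ R P N ω} ≤
      μA {ω | c ≤ ulCapacity α θ R P N ω} := by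
    rw [Measure.restrict_apply' hA]
    refine measure_mono_ae ?_
    filter_upwards [ae_finite_originCell hQB hQU hM hU.le] with s hs ⟨h, h'⟩
    exact ⟨h', originActive_of_hasUser hs h⟩
  have hgood' := ENNReal.toReal_mono (measure_ne_top _ _) hgood
  have h6 : (lamM / lamU)⁻¹ * (losProb lamM R - probLoss α P (lamM / lamU) ε) ≤
      μA.real {ω | c ≤ ulCapacity α θ R P N ω} := by
    -- The uplink loss is at most the downlink one, for which `probLoss` is designed.
    have h7 : P * (2 * Real.pi / (α - 2)) * ε ^ 2 ≤
        2 * P * 2 ^ α * (2 * Real.pi / (α - 2)) * ε ^ 2 := by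
      have h2α : (1 : ℝ) ≤ 2 ^ α := Real.one_le_rpow one_le_two (by linarith)
      have : P ≤ 2 * P * 2 ^ α := by nlinarith
      gcongr
    have h8 : 0 < 2 / (lamM / lamU) := by positivity
    have h9 : 4 / (lamM / lamU) = 2 * (2 / (lamM / lamU)) := by ring
    have h10 : losProb lamM R - probLoss α P (lamM / lamU) ε ≤ 1 - 2 / (lamM / lamU) -
        (Real.exp (-(lamM * Real.pi * goodRadius R lamM ε ^ 2)) + ε +
          (Real.pi * ε ^ 2 + P * (2 * Real.pi / (α - 2)) * ε ^ 2)) := by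
      unfold probLoss
      linarith
    refine (mul_le_mul_of_nonneg_left h10 (inv_nonneg.2 hr.le)).trans ?_
    rw [mul_sub]
    rw [measureReal_def] at hp2 ⊢
    linarith
  have h7 := mul_meas_ge_le_integral_of_nonneg (μ := μA) (Eventually.of_forall fun s =>
    ulCapacity_nonneg α θ R P N s) (integrable_ulCapacity (θ := θ) (by linarith) hP hN
      hR.le hM hU hQB hQU).integrableOn c
  rw [seUL_eq]
  have h8 : (lamM / lamU)⁻¹ * (losProb lamM R - probLoss α P (lamM / lamU) ε) * c ≤
      ∫ s, ulCapacity α θ R P N s ∂μA := by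
    refine le_trans ?_ h7
    rw [mul_comm]
    exact mul_le_mul_of_nonneg_left h6 hc0
  rw [inv_mul_eq_div, le_div_iff₀ hp0]
  refine le_trans ?_ h8
  have h9 := mul_le_mul_of_nonneg_left hp1 (mul_nonneg hpos hc0)
  linarith

end SpectralEfficiency

/-! ### Asymptotics -/

/-- A quantity between the bounds that hold for both spectral efficiencies is asymptotic to
`seLimit`. -/
theorem tendsto_div_seLimit {α P N : ℝ} (hα : 2 < α) {ι : Type*} {l : Filter ι}
    {lamM lamU R : ι → ℝ} (hM : ∀ i, 0 < lamM i) (hU : ∀ i, 0 < lamU i)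
    (hlim : Tendsto (fun i => lamM i / lamU i) l atTop)
    (hlamU : (fun i => Real.log (lamU i)) =o[l] fun i => Real.log (lamM i / lamU i))
    {p₀ : ℝ} (hp₀ : 0 < p₀) (hLOS : ∀ᶠ i in l, p₀ ≤ losProb (lamM i) (R i)) (hP : 0 < P)
    {K : ℝ} (hK : 0 ≤ K) {γ : ι → ℝ}
    (hupper : ∀ i, 2 < lamM i / lamU i → γ i ≤
      (α / 2 * Real.posLog (lamM i) * losProb (lamM i) (R i) + K) / (1 - 2 / (lamM i / lamU i)))
    (hlower : ∀ i ε, 0 < ε → 2 < lamM i / lamU i →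
      0 ≤ losProb (lamM i) (R i) - probLoss α P (lamM i / lamU i) ε →
      (losProb (lamM i) (R i) - probLoss α P (lamM i / lamU i) ε) *
        guaranteedCapacity α P N ε (goodRadius (R i) (lamM i) ε)
          (interferenceLevel α (lamU i) ε) ≤ γ i)
    (hN : 0 < N) (hR : ∀ i, 0 < R i) :
    Tendsto (fun i => γ i / seLimit α (R i) (lamM i) (lamU i)) l (𝓝 1) := by
  have hα0 : 0 < α := by linarith
  -- The lower bound is used with `ε = (L i)⁻¹`.
  let L : ι → ℝ := fun i => Real.log (lamM i / lamU i)
  have hL : Tendsto L l atTop := Real.tendsto_log_atTop.comp hlim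
  have hLinv : Tendsto (fun i => (L i)⁻¹) l (𝓝 0) := tendsto_inv_atTop_zero.comp hL
  have hrat : Tendsto (fun i => (lamM i / lamU i)⁻¹) l (𝓝 0) := tendsto_inv_atTop_zero.comp hlim
  have ha : Tendsto (fun i => |Real.log (lamU i)| / L i) l (𝓝 0) := by
    have h := hlamU.tendsto_div_nhds_zero.abs
    rw [abs_zero] at h
    refine h.congr' ?_
    filter_upwards [hL.eventually_gt_atTop 0] with i hi
    rw [abs_div, abs_of_pos hi]
  have hb : Tendsto (fun i => Real.log (L i) / L i) l (𝓝 0) :=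
    Real.isLittleO_log_id_atTop.tendsto_div_nhds_zero.comp hL
  have hloss : Tendsto (fun i => probLoss α P (lamM i / lamU i) (L i)⁻¹) l (𝓝 0) := by
    have h := ((hLinv.const_mul 2).add ((hLinv.pow 2).const_mul
      (Real.pi + 2 * P * 2 ^ α * (2 * Real.pi / (α - 2))))).add (hrat.const_mul 4)
    simpa [probLoss, div_eq_mul_inv] using h
  let C := |Real.log P| + Real.log (1 + N)
  -- `G` is the lower bound for the guaranteed capacity; `|log ε| = log (L i)`.
  let G : ι → ℝ := fun i => α / 2 * L i - α * |Real.log (lamU i)| -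
    (1 + 3 * α / 2) * Real.log (L i) - C
  have hG : Tendsto (fun i => G i / (α / 2 * L i)) l (𝓝 1) := by
    have h := ((ha.const_mul 2).add (hb.const_mul ((1 + 3 * α / 2) / (α / 2)))).add
      (hLinv.const_mul (C / (α / 2)))
    have h2 := tendsto_const_nhds (x := (1 : ℝ)).sub h
    simp only [mul_zero, add_zero, sub_zero] at h2
    refine h2.congr' ?_
    filter_upwards [hL.eventually_gt_atTop 0] with i hi
    simp only [G]
    field_simp
    ring
  have hlow : Tendsto (fun i => (1 - probLoss α P (lamM i / lamU i) (L i)⁻¹ / p₀) *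
      (G i / (α / 2 * L i))) l (𝓝 1) := by
    have h := (tendsto_const_nhds (x := (1 : ℝ)).sub (hloss.div_const p₀)).mul hG
    simpa using h
  have hupp : Tendsto (fun i => (1 + |Real.log (lamU i)| / L i + 2 * K / (α * p₀) * (L i)⁻¹) /
      (1 - 2 * (lamM i / lamU i)⁻¹)) l (𝓝 1) := by
    have h := ((tendsto_const_nhds (x := (1 : ℝ)).add ha).add
      (hLinv.const_mul (2 * K / (α * p₀)))).div
      (tendsto_const_nhds (x := (1 : ℝ)).sub (hrat.const_mul 2)) (by simp)
    simp only [mul_zero, add_zero, sub_zero, div_one] at h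
    exact h
  refine tendsto_of_tendsto_of_tendsto_of_le_of_le' hlow hupp ?_ ?_
  · filter_upwards [hLOS, hL.eventually_gt_atTop 1, hlim.eventually_gt_atTop 2,
      hloss.eventually (gt_mem_nhds hp₀), hG.eventually (lt_mem_nhds one_pos)]
      with i hi hLi hri hκ hGi
    have hL0 : 0 < L i := by linarith
    have hp : 0 < losProb (lamM i) (R i) := hp₀.trans_le hi
    have hpos : 0 ≤ losProb (lamM i) (R i) - probLoss α P (lamM i / lamU i) (L i)⁻¹ := by linarith
    have hκ0 : 0 ≤ probLoss α P (lamM i / lamU i) (L i)⁻¹ := by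
      have := Real.pi_pos
      have : 0 < α - 2 := by linarith
      have := hM i
      have := hU i
      unfold probLoss
      positivity
    have h1 := hlower i (L i)⁻¹ (inv_pos.2 hL0) hri hpos
    have h2 := le_guaranteedCapacity hα0 hP hN (hR i) (hM i) (hU i) (inv_pos.2 hL0)
    rw [Real.log_inv, abs_neg, abs_of_pos (Real.log_pos hLi)] at h2
    change G i ≤ _ at h2
    have h3 := (mul_le_mul_of_nonneg_left h2 hpos).trans h1
    have hden : 0 < seLimit α (R i) (lamM i) (lamU i) := by
      change 0 < α * losProb (lamM i) (R i) / 2 * L i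
      positivity
    rw [le_div_iff₀ hden]
    refine le_trans (le_of_eq ?_) ((mul_le_mul_of_nonneg_right
      (b := (1 - probLoss α P (lamM i / lamU i) (L i)⁻¹ / p₀) * losProb (lamM i) (R i))
      ?_ ?_).trans h3)
    · change _ * (α * losProb (lamM i) (R i) / 2 * L i) = ((1 - probLoss α P (lamM i / lamU i)
        (L i)⁻¹ / p₀) * losProb (lamM i) (R i)) * G i
      field_simp
    · rw [sub_mul, one_mul]
      have : probLoss α P (lamM i / lamU i) (L i)⁻¹ * 1 ≤
          probLoss α P (lamM i / lamU i) (L i)⁻¹ * (losProb (lamM i) (R i) / p₀) :=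
        mul_le_mul_of_nonneg_left ((one_le_div hp₀).2 hi) hκ0
      have h4 : probLoss α P (lamM i / lamU i) (L i)⁻¹ / p₀ * losProb (lamM i) (R i) =
        probLoss α P (lamM i / lamU i) (L i)⁻¹ * (losProb (lamM i) (R i) / p₀) := by ring
      linarith
    · exact ((div_pos_iff_of_pos_right (by positivity)).1 hGi).le
  · filter_upwards [hLOS, hL.eventually_gt_atTop 1, hlim.eventually_gt_atTop 2] with i hi hLi hri
    have hL0 : 0 < L i := by linarith
    have hp : 0 < losProb (lamM i) (R i) := hp₀.trans_le hi
    have hden : 0 < seLimit α (R i) (lamM i) (lamU i) := by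
      change 0 < α * losProb (lamM i) (R i) / 2 * L i
      positivity
    have hd : 0 < 1 - 2 / (lamM i / lamU i) := by
      rw [sub_pos, div_lt_one (by linarith)]; exact hri
    rw [div_le_iff₀ hden]
    refine (hupper i hri).trans ?_
    rw [← div_eq_mul_inv 2, div_mul_eq_mul_div (_ + _)]
    refine div_le_div_of_nonneg_right ?_ hd.le
    have h1 : Real.posLog (lamM i) ≤ L i + |Real.log (lamU i)| := by
      refine max_le (by positivity) ?_
      simp only [L]
      rw [Real.log_div (hM i).ne' (hU i).ne']
      linarith [le_abs_self (Real.log (lamU i))]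
    have h2 : K ≤ K * (losProb (lamM i) (R i) / p₀) :=
      le_mul_of_one_le_right hK ((one_le_div hp₀).2 hi)
    calc _ ≤ α / 2 * (L i + |Real.log (lamU i)|) * losProb (lamM i) (R i) +
          K * (losProb (lamM i) (R i) / p₀) := by gcongr
      _ = _ := by
        change _ = _ * (α * losProb (lamM i) (R i) / 2 * L i)
        field_simp

end

theorem theorem2
    (α θ Pd Pu N : ℝ) (hα : 2 < α) (hθ : 0 < θ) (hθ' : θ ≤ 2 * Real.pi)
    (hPd : 0 < Pd) (hPu : 0 < Pu) (hN : 0 < N)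
    {ι : Type*} (l : Filter ι) (lamM lamU R : ι → ℝ)
    (hM : ∀ i, 0 < lamM i) (hU : ∀ i, 0 < lamU i) (hR : ∀ i, 0 < R i)
    (hlim : Tendsto (fun i => lamM i / lamU i) l atTop)
    (hlamU : (fun i => Real.log (lamU i)) =o[l] fun i => Real.log (lamM i / lamU i))
    (p₀ : ℝ) (hp₀ : 0 < p₀) (hLOS : ∀ᶠ i in l, p₀ ≤ losProb (lamM i) (R i))
    (QB QU : ι → Measure (ℕ → Plane))
    (hQB : ∀ i, IsPoissonProcess (QB i) (lamM i))
    (hQU : ∀ i, IsPoissonProcess (QU i) (lamU i)) :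
    (∀ i, Integrable (dlCapacity α θ (R i) Pd N) (networkLaw (QB i) (QU i)) ∧
      Integrable (ulCapacity α θ (R i) Pu N) (activeLaw (QB i) (QU i))) ∧
    Tendsto (fun i => seDL α θ (R i) Pd N (QB i) (QU i) /
      seLimit α (R i) (lamM i) (lamU i)) l (𝓝 1) ∧
    Tendsto (fun i => seUL α θ (R i) Pu N (QB i) (QU i) /
      seLimit α (R i) (lamM i) (lamU i)) l (𝓝 1) := by
  have hα0 : 0 < α := by linarith
  have hprob : ∀ i, IsProbabilityMeasure (QU i) := fun i => (hQU i).prob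
  have hpi := Real.pi_pos
  refine ⟨fun i => ⟨?_, ?_⟩, ?_, ?_⟩
  · exact integrable_dlCapacity hα0 hPd hN (hR i).le (hM i) (hQB i)
  · exact integrable_ulCapacity_activeLaw hα0 hPu hN (hR i).le (hM i) (hU i) (hQB i) (hQU i)
  · refine tendsto_div_seLimit (P := Pd) (N := N) (K := Pd / N + 2 * Real.pi * α) hα hM hU hlim
      hlamU hp₀ hLOS hPd (by positivity) ?_ ?_ hN hR
    · intro i hi
      have hd : 0 < 1 - 2 / (lamM i / lamU i) := by
        rw [sub_pos, div_lt_one (by linarith)]; exact hi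
      have hd' : 0 < 2 / (lamM i / lamU i) := div_pos two_pos (by linarith)
      have hpl := Real.posLog_nonneg (x := lamM i)
      have hlos := losProb_nonneg (R := R i) (hM i).le
      refine (seDL_le hα0 hPd hN (hR i).le (hM i) (hQB i)).trans ?_
      exact le_div_self (by positivity) hd (by linarith)
    · intro i ε hε _ _
      exact le_seDL hα hPd hN (hR i) (hM i) (hU i) (hQB i) (hQU i) hε
  · refine tendsto_div_seLimit (P := Pu) (N := N) (K := Pu / N + 2 * Real.pi * α) hα hM hU hlim
      hlamU hp₀ hLOS hPu (by positivity) ?_ ?_ hN hR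
    · intro i hi
      exact seUL_le hα0 hPu hN (hR i).le (hM i) (hU i) (hQB i) (hQU i) hi
    · intro i ε hε hi hpos
      exact le_seUL hα hPu hN (hR i) (hM i) (hU i) (hQB i) (hQU i) hε hi hpos
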